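/- Let $\mathbb H^2$ be the hyperbolic plane with polar coordinates $(r,\theta)$ about a fixed origin and metric $\mathbf h=dr^2+\sinh^2 r\,d\theta^2$. Let $\mathcal N=\mathbb S^2$ or $\mathcal N=\mathbb H^2$, with Gauss curvature $\kappa=+1$ or $\kappa=-1$ respectively, geodesic polar coordinates $(\rho,\vartheta)$ about a fixed origin, and Riemann curvature tensor $R(X,Y)Z=\kappa\,((Y,Z)X-(X,Z)Y)$. Consider the following equivariant maps $Q:\mathbb H^2\to\mathcal N$ (they are the finite energy equivariant harmonic maps given by the standard classification): - if $\mathcal N=\mathbb H^2$: $Q(r,\theta)=\big(2\,\mathrm{artanh}(\lambda\tanh(r/2)),\theta\big)$ with $\lambda=\tanh(\beta/2)$, $0\le\beta<\infty$; - if $\mathcal N=\mathbb S^2$: $Q(r,\theta)=\big(2\arctan(\lambda\tanh(r/2)),\theta\big)$ with $\lambda=\tan(\alpha/2)$, $0\le\alpha<\pi$. Thus $\lim_{r\to\infty}Q(r,\theta)=(\beta,\theta)$, respectively $(\alpha,\theta)$. Let $D$ be the pullback of the Levi-Civita connection to $Q^*T\mathcal N$, and for sections $\phi$ of $Q^*T\mathcal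 N$ let $$\mathcal H_Q\phi=-D^\ell D_\ell\phi-R(Q)(\phi,\partial_\ell Q)\partial^\ell Q,$$ $$\|\phi\|_{\mathbf H^1_{thr}}=\big\|(D_r+\tfrac12)\phi\big\|_{L^2}+\Big\|\frac1{\sinh r}D_\theta\phi\Big\|_{L^2}+\Big\|\frac{1}{(1+r^2)^{1/2}}\phi\Big\|_{L^2},$$ where $L^2$ norms and integrals are taken with respect to the Riemannian volume of $\mathbb H^2$, and let $$\|f\|_{\mathbf H^{-1}_{thr}}=\sup\Big\{\Big|\int_{\mathbb H^2}(f,\chi)\Big| : \chi\in C^\infty_c(Q^*T\mathcal N),\ \|\chi\|_{\mathbf H^1_{thr}}\le1\Big\}$$ be the dual norm. We say that $Q$ satisfies the strong linearized stability condition if 1. (no eigenvalues below $\tfrac14$) $\displaystyle\int_{\mathbb H^2}(\mathcal H_Q\phi,\phi)\ \ge\ \tfrac14\int_{\mathbb H^2}(\phi,\phi)$ for every smooth compactly supported section $\phi$ of $Q^*T\mathcal N$; and 2. (no threshold resonance) there is $C_0>0$ such that $\|\phi\|_{\mathbf H^1_{thr}}\le C_0\,\|(\tfrac14-\mathcal H_Q)\phi\|_{\mathbf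 H^{-1}_{thr}}$ for every smooth compactly supported section $\phi$ of $Q^*T\mathcal N$. **Proposition.** (1) If $\mathcal N=\mathbb H^2$, then for every $\beta\ge0$ the map $Q$ satisfies the strong linearized stability condition. (2) If $\mathcal N=\mathbb S^2$, there is $\alpha_0\in(0,\pi)$ such that for every $0\le\alpha<\alpha_0$ the map $Q$ satisfies the strong linearized stability condition. -/

import Mathlib

open MeasureTheory
open scoped ContDiff ENNReal

namespace HarmonicStability

noncomputable section

/-! ### The two target surfaces, inside `ℝ³` -/

/-- The two possible target surfaces: the unit sphere `𝕊²` and the hyperbolic plane `ℍ²`. -/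
inductive Target
  | sphere
  | hyperbolic

/-- The Gauss curvature of the target. -/
def Target.curv : Target → ℝ
  | .sphere => 1
  | .hyperbolic => -1

/-- The ambient space `ℝ³`; the third coordinate is the axis of rotation (the time direction in
the Minkowski case). -/
abbrev Ambient : Type := Fin 3 → ℝ

/-- The ambient bilinear form `u₁v₁ + u₂v₂ + κ u₃v₃`: the Euclidean inner product for the sphere
and the Minkowski form for the hyperbolic plane. Its restriction to tangent planes of the target
is the Riemannian metric of the target. -/
def Target.form (N : Target) (u v : Ambient) : ℝ :=
  u 0 * v 0 + u 1 * v 1 + N.curv * (u 2 * v 2)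

/-- The target surface: the unit sphere in Euclidean `ℝ³`, or the upper sheet of the unit
hyperboloid in Minkowski space. -/
def Target.surface : Target → Set Ambient
  | .sphere => {u | Target.sphere.form u u = 1}
  | .hyperbolic => {u | Target.hyperbolic.form u u = -1 ∧ 0 < u 2}

/-- The orthogonal projection of the ambient space onto the tangent plane `T_p N = p^⊥` at a point
`p` of the target (note that `⟨p, p⟩ = κ = 1 / κ`). -/
def Target.proj (N : Target) (p v : Ambient) : Ambient :=
  v - (N.curv * N.form v p) • p

/-- The Riemann curvature operator of the surface of constant curvature `κ`:
`R(X, Y) Z = κ (⟨Y, Z⟩ X - ⟨X, Z⟩ Y)`. -/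
def Target.curvOp (N : Target) (X Y Z : Ambient) : Ambient :=
  N.curv • (N.form Y Z • X - N.form X Z • Y)

/-- `S(ρ) = sin ρ` for the sphere, `sinh ρ` for the hyperbolic plane. -/
def Target.S : Target → ℝ → ℝ
  | .sphere => Real.sin
  | .hyperbolic => Real.sinh

/-- `S'(ρ) = cos ρ` for the sphere, `cosh ρ` for the hyperbolic plane. -/
def Target.S' : Target → ℝ → ℝ
  | .sphere => Real.cos
  | .hyperbolic => Real.cosh

/-- The point of the target with geodesic polar coordinates `(ρ, ϑ)` about `(0, 0, 1)`. -/
def Target.polarPoint (N : Target) (ρ ϑ : ℝ) : Ambient :=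
  ![N.S ρ * Real.cos ϑ, N.S ρ * Real.sin ϑ, N.S' ρ]

/-! ### The domain: the hyperbolic plane in its global coordinates `(y¹, y²)` -/

/-- The coordinate plane of the domain. -/
abbrev Plane : Type := EuclideanSpace ℝ (Fin 2)

/-- The inclusion of the domain `ℍ²`, written in the global coordinates `y = (y¹, y²)`, as the
hyperboloid in Minkowski space. -/
def incl (y : Plane) : Ambient := ![y 0, y 1, Real.sqrt (1 + ‖y‖ ^ 2)]

/-- The coordinate vector field `∂_j`. -/
def basisVec (j : Fin 2) : Plane := EuclideanSpace.single j 1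

/-- The metric of the domain: the pullback of the Minkowski metric by the inclusion. -/
def metric (y : Plane) : Matrix (Fin 2) (Fin 2) ℝ :=
  Matrix.of fun j k =>
    Target.hyperbolic.form (fderiv ℝ incl y (basisVec j)) (fderiv ℝ incl y (basisVec k))

/-- The inverse metric `h^{jk}`. -/
def invMetric (y : Plane) : Matrix (Fin 2) (Fin 2) ℝ := (metric y)⁻¹

/-- The partial derivative `∂_i h_{jk}`. -/
def dMetric (i j k : Fin 2) (y : Plane) : ℝ := fderiv ℝ (fun x => metric x j k) y (basisVec i)

/-- The Christoffel symbol `Γ^l_{jk}` of the domain. -/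
def christoffel (l j k : Fin 2) (y : Plane) : ℝ :=
  1 / 2 * ∑ m, invMetric y l m * (dMetric j k m y + dMetric k m j y - dMetric m j k y)

/-- The Riemannian volume of the domain. -/
def vol : Measure Plane :=
  (volume : Measure Plane).withDensity fun y => ENNReal.ofReal (Real.sqrt (metric y).det)

/-- The geodesic distance `r` to the origin; the polar coordinates `(r, θ)` of the domain are given
by `y = (sinh r cos θ, sinh r sin θ)`. -/
def radius (y : Plane) : ℝ := Real.arsinh ‖y‖

/-- The unit radial vector field `∂_r` (off the origin). -/
def radialVec (y : Plane) : Plane := (Real.sqrt (1 + ‖y‖ ^ 2) / ‖y‖) • y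

/-- The unit angular vector field `(sinh r)⁻¹ ∂_θ` (off the origin). -/
def angularVec (y : Plane) : Plane := ‖y‖⁻¹ • !₂[-(y 1), y 0]

/-- The point of the domain with geodesic polar coordinates `(r, θ)`. -/
def domPoint (r θ : ℝ) : Plane := !₂[Real.sinh r * Real.cos θ, Real.sinh r * Real.sin θ]

/-! ### The equivariant harmonic maps -/

/-- The polar radius `ρ(r) = 2 arctan(λ tanh(r/2))` (sphere), `2 artanh(λ tanh(r/2))` (hyperbolic
plane) of the harmonic map with parameter `λ`. -/
def Target.profile : Target → ℝ → ℝ → ℝ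
  | .sphere, lam, r => 2 * Real.arctan (lam * Real.tanh (r / 2))
  | .hyperbolic, lam, r => 2 * Real.artanh (lam * Real.tanh (r / 2))

/-- The equivariant harmonic map `(r, θ) ↦ (ρ(r), θ)` with parameter `λ`. At a point `y ≠ 0` one
has `(cos θ, sin θ) = y / ‖y‖`, and the origin is sent to `(0, 0, 1)`. -/
def harmonicMap (N : Target) (lam : ℝ) (y : Plane) : Ambient :=
  ![N.S (N.profile lam (radius y)) * (y 0 / ‖y‖), N.S (N.profile lam (radius y)) * (y 1 / ‖y‖),
    N.S' (N.profile lam (radius y))]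

/-! ### Analysis on the pullback bundle `Q^* T N` -/

/-- The pullback covariant derivative `D_v φ` at `y` of a section `φ` of `Q^* T N`: the tangential
projection of the ambient derivative. -/
def covD (N : Target) (Q φ : Plane → Ambient) (v y : Plane) : Ambient :=
  N.proj (Q y) (fderiv ℝ φ y v)

/-- The second covariant derivative `(D² φ)_{jk} = D_j D_k φ - Γ^l_{jk} D_l φ`. -/
def covD2 (N : Target) (Q φ : Plane → Ambient) (j k : Fin 2) (y : Plane) : Ambient :=
  covD N Q (fun x => covD N Q φ (basisVec k) x) (basisVec j) y
    - ∑ l, christoffel l j k y • covD N Q φ (basisVec l) y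

/-- The linearized operator
`𝓗_Q φ = - D^ℓ D_ℓ φ - R(Q)(φ, ∂_ℓ Q) ∂^ℓ Q`. -/
def linOp (N : Target) (Q φ : Plane → Ambient) (y : Plane) : Ambient :=
  -(∑ j, ∑ k, invMetric y j k • covD2 N Q φ j k y)
    - ∑ j, ∑ k, invMetric y j k •
        N.curvOp (φ y) (fderiv ℝ Q y (basisVec j)) (fderiv ℝ Q y (basisVec k))

/-- Smooth compactly supported sections of `Q^* T N`. -/
structure IsTestSection (N : Target) (Q φ : Plane → Ambient) : Prop where
  smooth : ContDiff ℝ ∞ φ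
  compact : HasCompactSupport φ
  tangent : ∀ y, N.form (φ y) (Q y) = 0

/-- The `L²` pairing `∫ (φ, χ)` of sections of `Q^* T N`. -/
def pairing (N : Target) (φ χ : Plane → Ambient) : ℝ := ∫ y, N.form (φ y) (χ y) ∂vol

/-- The `L²` norm of a section of `Q^* T N`. -/
def normL2 (N : Target) (φ : Plane → Ambient) : ℝ≥0∞ :=
  (∫⁻ y, ENNReal.ofReal (N.form (φ y) (φ y)) ∂vol) ^ (1 / 2 : ℝ)

/-- The norm `‖φ‖_{H¹_thr}`. -/
def normThr (N : Target) (Q φ : Plane → Ambient) : ℝ≥0∞ :=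
  normL2 N (fun y => covD N Q φ (radialVec y) y + (1 / 2 : ℝ) • φ y)
    + normL2 N (fun y => covD N Q φ (angularVec y) y)
    + normL2 N (fun y => (Real.sqrt (1 + radius y ^ 2))⁻¹ • φ y)

/-- The dual norm `‖f‖_{H⁻¹_thr}`, with respect to the `L²` pairing. -/
def normThrDual (N : Target) (Q f : Plane → Ambient) : ℝ≥0∞ :=
  ⨆ (χ : Plane → Ambient) (_ : IsTestSection N Q χ) (_ : normThr N Q χ ≤ 1),
    ENNReal.ofReal |pairing N f χ|

/-- The strong linearized stability condition. -/
structure StronglyStable (N : Target) (Q : Plane → Ambient) : Prop where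
  no_eigenvalue : ∀ φ, IsTestSection N Q φ →
    pairing N (linOp N Q φ) φ ≥ 1 / 4 * pairing N φ φ
  no_resonance : ∃ C₀ : ℝ, 0 < C₀ ∧ ∀ φ, IsTestSection N Q φ →
    normThr N Q φ ≤
      ENNReal.ofReal C₀ * normThrDual N Q (fun y => (1 / 4 : ℝ) • φ y - linOp N Q φ y)

/-! ### The explicit map in polar coordinates -/

theorem norm_domPoint {r : ℝ} (hr : 0 ≤ r) (θ : ℝ) : ‖domPoint r θ‖ = Real.sinh r := by
  have h : (Real.sinh r * Real.cos θ) ^ 2 + (Real.sinh r * Real.sin θ) ^ 2 = Real.sinh r ^ 2 := by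
    linear_combination Real.sinh r ^ 2 * Real.sin_sq_add_cos_sq θ
  simp only [domPoint, EuclideanSpace.norm_eq, Fin.sum_univ_two, Real.norm_eq_abs, sq_abs]
  simp only [Matrix.cons_val_zero, Matrix.cons_val_one]
  rw [h, Real.sqrt_sq (Real.sinh_nonneg_iff.mpr hr)]

/-- In polar coordinates the map is `(r, θ) ↦ (ρ(r), θ)`. -/
theorem harmonicMap_domPoint (N : Target) (lam : ℝ) {r : ℝ} (hr : 0 ≤ r) (θ : ℝ) :
    harmonicMap N lam (domPoint r θ) = N.polarPoint (N.profile lam r) θ := by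
  have hrad : radius (domPoint r θ) = r := by
    rw [radius, norm_domPoint hr, Real.arsinh_sinh]
  rw [harmonicMap, hrad, norm_domPoint hr]
  rcases hr.eq_or_lt with rfl | hpos
  · have h0 : N.S (N.profile lam 0) = 0 := by
      cases N <;> simp [Target.S, Target.profile]
    simp [h0, Target.polarPoint]
  · have hs : Real.sinh r ≠ 0 := (Real.sinh_pos_iff.mpr hpos).ne'
    simp [domPoint, Target.polarPoint, hs]

/-- The map takes values in the target. -/
theorem harmonicMap_mem (N : Target) (lam : ℝ) (y : Plane) :
    harmonicMap N lam y ∈ N.surface := by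
  have hn : ‖y‖ ^ 2 = y 0 ^ 2 + y 1 ^ 2 := by
    simp [EuclideanSpace.norm_sq_eq, Fin.sum_univ_two]
  rcases eq_or_ne y 0 with rfl | hy
  · cases N <;> simp [harmonicMap, Target.surface, Target.form, Target.curv, Target.S', radius,
      Target.profile]
  · have h1 : (y 0 / ‖y‖) ^ 2 + (y 1 / ‖y‖) ^ 2 = 1 := by
      have : ‖y‖ ^ 2 ≠ 0 := pow_ne_zero 2 (norm_ne_zero_iff.mpr hy)
      rw [div_pow, div_pow, ← add_div, ← hn, div_self this]
    cases N
    · have h := Real.sin_sq_add_cos_sq (Target.sphere.profile lam (radius y))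
      simp only [harmonicMap, Target.surface, Target.form, Target.curv, Target.S', Target.S,
        Set.mem_ofPred_eq, Matrix.cons_val_zero, Matrix.cons_val_one, Matrix.cons_val]
      linear_combination Real.sin (Target.sphere.profile lam (radius y)) ^ 2 * h1 + h
    · have h := Real.cosh_sq_sub_sinh_sq (Target.hyperbolic.profile lam (radius y))
      simp only [harmonicMap, Target.surface, Target.form, Target.curv, Target.S', Target.S,
        Set.mem_ofPred_eq, Matrix.cons_val_zero, Matrix.cons_val_one, Matrix.cons_val]
      refine ⟨?_, Real.cosh_pos _⟩
      linear_combination Real.sinh (Target.hyperbolic.profile lam (radius y)) ^ 2 * h1 - h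

end

end HarmonicStability

/-! The bottom `1/4` of the spectrum is removed by a logarithmic Hardy inequality that leaves a
positive remainder, and the curvature term is shown to fit inside that remainder.

Let `p = (2 + log cosh r)⁻¹` and `f = (p cosh r)^(-1/2)`, a positive supersolution at the threshold.
With `b = -f'/f = (1/2)(1 - p) tanh r`, adding the divergence of `b |φ|² ∂_r` to the quadratic form
of `𝓗_Q - 1/4` completes the square: the density becomes `|D_r φ + b φ|²` plus the angular energy,
plus a potential at least `p²/4` times `|φ|²`, minus the curvature term (`stabilityDensity_eq`).

For the hyperbolic target the curvature term is nonpositive (`curvTerm_nonpos`). For the sphere it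
is at most `|dQ|² |φ|²`, and since `Q` is conformal `|dQ|²` is explicit and at most `p²/8` for small
`λ` (`sphere_curvTerm_le`). In both cases `p²/8` of the potential survives.

As `1/2 - b` and `(1 + r²)^(-1/2)` are `O(p)`, the form then controls the square of the threshold
norm (`normThr_le`). Nonnegativity gives the first condition; pairing `(1/4 - 𝓗_Q) φ` with `φ` and
using duality gives the second (`stronglyStable_of_curvTerm_le`). -/

namespace HarmonicStability

noncomputable section

/-! ### Geometry of the domain in global coordinates -/

/-- The function `cosh r` in the global coordinates of the domain. -/
def coshRadius (y : Plane) : ℝ := Real.sqrt (1 + ‖y‖ ^ 2)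

theorem norm_sq_plane (y : Plane) : ‖y‖ ^ 2 = y 0 ^ 2 + y 1 ^ 2 := by
  simp [EuclideanSpace.norm_sq_eq, Fin.sum_univ_two]

theorem coshRadius_sq (y : Plane) : coshRadius y ^ 2 = 1 + y 0 ^ 2 + y 1 ^ 2 := by
  rw [coshRadius, Real.sq_sqrt (by positivity), norm_sq_plane, add_assoc]

theorem coshRadius_pos (y : Plane) : 0 < coshRadius y := Real.sqrt_pos.mpr (by positivity)

theorem one_le_coshRadius (y : Plane) : 1 ≤ coshRadius y := by
  have := coshRadius_sq y
  nlinarith [coshRadius_pos y, sq_nonneg (y 0), sq_nonneg (y 1)]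

theorem contDiff_coshRadius : ContDiff ℝ ∞ coshRadius :=
  (contDiff_const.add (contDiff_norm_sq ℝ)).sqrt fun y => by positivity

theorem contDiff_coord (j : Fin 2) : ContDiff ℝ ∞ fun y : Plane => y j :=
  (EuclideanSpace.proj (𝕜 := ℝ) j : Plane →L[ℝ] ℝ).contDiff

theorem hasFDerivAt_coord (j : Fin 2) (y : Plane) :
    HasFDerivAt (fun y : Plane => y j) (EuclideanSpace.proj (𝕜 := ℝ) j : Plane →L[ℝ] ℝ) y :=
  (EuclideanSpace.proj (𝕜 := ℝ) j : Plane →L[ℝ] ℝ).hasFDerivAt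

theorem fderiv_coord (j : Fin 2) (y v : Plane) : fderiv ℝ (fun y : Plane => y j) y v = v j := by
  rw [(hasFDerivAt_coord j y).fderiv]; rfl

theorem hasFDerivAt_coshRadius (y : Plane) :
    HasFDerivAt coshRadius ((coshRadius y)⁻¹ • innerSL ℝ y) y := by
  have h := ((hasStrictFDerivAt_norm_sq y).hasFDerivAt.const_add 1).sqrt
    (by positivity : (1 + ‖y‖ ^ 2) ≠ 0)
  refine h.congr_fderiv ?_
  ext v
  have := (coshRadius_pos y).ne'
  simp only [coshRadius] at *
  simp
  field_simp

theorem fderiv_coshRadius (y v : Plane) :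
    fderiv ℝ coshRadius y v = (y 0 * v 0 + y 1 * v 1) / coshRadius y := by
  rw [(hasFDerivAt_coshRadius y).fderiv]
  simp [PiLp.inner_apply, Fin.sum_univ_two]
  ring

theorem fderiv_incl (y v : Plane) :
    fderiv ℝ incl y v = ![v 0, v 1, (y 0 * v 0 + y 1 * v 1) / coshRadius y] := by
  have hd : ∀ i, DifferentiableAt ℝ (fun x => incl x i) y := by
    intro i
    fin_cases i
    · exact (hasFDerivAt_coord 0 y).differentiableAt
    · exact (hasFDerivAt_coord 1 y).differentiableAt
    · exact (hasFDerivAt_coshRadius y).differentiableAt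
  rw [show incl = fun x i => incl x i from rfl, fderiv_pi hd]
  ext i
  fin_cases i
  · exact fderiv_coord 0 y v
  · exact fderiv_coord 1 y v
  · exact fderiv_coshRadius y v

@[simp] theorem basisVec_apply (j k : Fin 2) : basisVec j k = if k = j then 1 else 0 := by
  simp [basisVec]

theorem metric_apply (y : Plane) (j k : Fin 2) :
    metric y j k = (if j = k then 1 else 0) - y j * y k / (1 + y 0 ^ 2 + y 1 ^ 2) := by
  rw [← coshRadius_sq]
  have := (coshRadius_pos y).ne'
  simp only [metric, Matrix.of_apply, fderiv_incl, Target.form, Target.curv]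
  fin_cases j <;> fin_cases k <;> simp <;> field_simp <;> ring

theorem invMetric_eq (y : Plane) :
    invMetric y = !![1 + y 0 ^ 2, y 0 * y 1; y 0 * y 1, 1 + y 1 ^ 2] := by
  have h : (1 + y 0 ^ 2 + y 1 ^ 2) ≠ 0 := by positivity
  refine Matrix.inv_eq_right_inv ?_
  ext j k
  fin_cases j <;> fin_cases k <;> simp [Matrix.mul_apply, Fin.sum_univ_two, metric_apply] <;>
    field_simp <;> ring

theorem det_metric (y : Plane) : (metric y).det = (coshRadius y ^ 2)⁻¹ := by
  have h : (1 + y 0 ^ 2 + y 1 ^ 2) ≠ 0 := by positivity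
  rw [Matrix.det_fin_two, coshRadius_sq]
  simp only [metric_apply]
  simp
  field_simp
  ring

theorem sqrt_det_metric (y : Plane) : Real.sqrt (metric y).det = (coshRadius y)⁻¹ := by
  rw [det_metric, Real.sqrt_inv, Real.sqrt_sq (coshRadius_pos y).le]

theorem hasFDerivAt_div {E : Type*} [NormedAddCommGroup E] [NormedSpace ℝ E] {f g : E → ℝ}
    {f' g' : E →L[ℝ] ℝ} {x : E} (hf : HasFDerivAt f f' x) (hg : HasFDerivAt g g' x)
    (h : g x ≠ 0) :
    HasFDerivAt (fun z => f z / g z) ((g x)⁻¹ • f' - (f x / g x ^ 2) • g') x := by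
  have h1 := hf.mul ((hasDerivAt_inv h).comp_hasFDerivAt x hg)
  refine (h1.congr_fderiv ?_).congr_of_eventuallyEq (Filter.Eventually.of_forall fun z => ?_)
  · ext v
    simp
    field_simp
    ring
  · simp [div_eq_mul_inv]

theorem dMetric_eq (i j k : Fin 2) (y : Plane) :
    dMetric i j k y =
      -(((if j = i then 1 else 0) * y k + y j * (if k = i then 1 else 0)) *
          (1 + y 0 ^ 2 + y 1 ^ 2) - y j * y k * (2 * y i)) / (1 + y 0 ^ 2 + y 1 ^ 2) ^ 2 := by
  have h : (1 + y 0 ^ 2 + y 1 ^ 2) ≠ 0 := by positivity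
  have h1 := hasFDerivAt_div ((hasFDerivAt_coord j y).mul (hasFDerivAt_coord k y))
    ((((hasFDerivAt_coord 0 y).pow 2).const_add 1).add ((hasFDerivAt_coord 1 y).pow 2)) h
  have h2 := h1.const_sub (if j = k then (1 : ℝ) else 0)
  have h3 : (fun x => metric x j k) = fun x : Plane =>
      (if j = k then (1 : ℝ) else 0) - x j * x k / (1 + x 0 ^ 2 + x 1 ^ 2) := by
    ext x; exact metric_apply x j k
  rw [dMetric, h3]
  erw [h2.fderiv]
  fin_cases i <;> fin_cases j <;> fin_cases k <;> simp <;> field_simp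

/-- Equivalent to `Δ y^l = 2 y^l`: the Minkowski coordinates are eigenfunctions of the Laplacian on
the hyperboloid. This is all that the Christoffel symbols contribute to the trace of the second
covariant derivative. -/
theorem contracted_christoffel (l : Fin 2) (y : Plane) :
    ∑ j, ∑ k, invMetric y j k * christoffel l j k y = -2 * y l := by
  have h : (1 + y 0 ^ 2 + y 1 ^ 2) ≠ 0 := by positivity
  simp only [christoffel, Fin.sum_univ_two, dMetric_eq, invMetric_eq]
  fin_cases l <;> simp <;> field_simp <;> ring

/-! ### Linear algebra on the tangent planes of the target -/

namespace Target

variable (N : Target)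

theorem curv_mul_self : N.curv * N.curv = 1 := by cases N <;> simp [curv]

theorem form_comm (u v : Ambient) : N.form u v = N.form v u := by simp only [form]; ring

theorem form_add_left (u v w : Ambient) : N.form (u + v) w = N.form u w + N.form v w := by
  simp only [form, Pi.add_apply]; ring

theorem form_sub_left (u v w : Ambient) : N.form (u - v) w = N.form u w - N.form v w := by
  simp only [form, Pi.sub_apply]; ring

theorem form_neg_left (u w : Ambient) : N.form (-u) w = -N.form u w := by
  simp only [form, Pi.neg_apply]; ring

theorem form_smul_left (a : ℝ) (u w : Ambient) : N.form (a • u) w = a * N.form u w := by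
  simp only [form, Pi.smul_apply, smul_eq_mul]; ring

theorem form_zero_left (w : Ambient) : N.form 0 w = 0 := by simp [form]

theorem form_add_right (u v w : Ambient) : N.form w (u + v) = N.form w u + N.form w v := by
  simp only [form, Pi.add_apply]; ring

theorem form_sub_right (u v w : Ambient) : N.form w (u - v) = N.form w u - N.form w v := by
  simp only [form, Pi.sub_apply]; ring

theorem form_smul_right (a : ℝ) (u w : Ambient) : N.form w (a • u) = a * N.form w u := by
  simp only [form, Pi.smul_apply, smul_eq_mul]; ring

theorem form_zero_right (w : Ambient) : N.form w 0 = 0 := by simp [form]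

theorem proj_add (p u v : Ambient) : N.proj p (u + v) = N.proj p u + N.proj p v := by
  simp only [proj, form_add_left]; module

theorem proj_smul (p : Ambient) (a : ℝ) (u : Ambient) : N.proj p (a • u) = a • N.proj p u := by
  simp only [proj, form_smul_left]; module

theorem form_proj_self {p : Ambient} (hp : N.form p p = N.curv) (v : Ambient) :
    N.form (N.proj p v) p = 0 := by
  rw [proj, form_sub_left, form_smul_left, hp]
  linear_combination (-N.form v p) * N.curv_mul_self

theorem form_proj_left {p w : Ambient} (hw : N.form w p = 0) (v : Ambient) :
    N.form (N.proj p v) w = N.form v w := by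
  rw [proj, form_sub_left, form_smul_left, N.form_comm p w, hw, mul_zero, sub_zero]

/-- The metric of the target is nonnegative on its tangent planes. -/
theorem form_self_nonneg {p v : Ambient} (hp : p ∈ N.surface) (hv : N.form v p = 0) :
    0 ≤ N.form v v := by
  cases N
  · simp only [form, curv]
    nlinarith [mul_self_nonneg (v 0), mul_self_nonneg (v 1), mul_self_nonneg (v 2)]
  · obtain ⟨hp, -⟩ := hp
    simp only [form, curv] at hp hv ⊢
    -- Tangency and `p₂² = 1 + p₀² + p₁²` turn `p₂² ⟨v, v⟩` into `v₀² + v₁² + (v₀ p₁ - v₁ p₀)²`.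
    have h2 : 0 < p 2 * p 2 := by nlinarith [mul_self_nonneg (p 0), mul_self_nonneg (p 1)]
    refine nonneg_of_mul_nonneg_left ?_ h2
    have h3 : (v 2 * p 2) ^ 2 = (v 0 * p 0 + v 1 * p 1) ^ 2 := by
      congr 1; linarith
    nlinarith [sq_nonneg (v 0 * p 1 - v 1 * p 0), mul_self_nonneg (v 0), mul_self_nonneg (v 1),
      h3, hp]

theorem form_self_of_mem {p : Ambient} (hp : p ∈ N.surface) : N.form p p = N.curv := by
  cases N
  · exact hp
  · exact hp.1

/-- The Cauchy–Schwarz inequality on the tangent planes of the target. -/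
theorem form_mul_self_le {p u v : Ambient} (hp : p ∈ N.surface) (hu : N.form u p = 0)
    (hv : N.form v p = 0) : N.form u v * N.form u v ≤ N.form u u * N.form v v := by
  have h : ∀ t : ℝ, 0 ≤ N.form v v * (t * t) + 2 * N.form u v * t + N.form u u := by
    intro t
    have h1 := N.form_self_nonneg (v := u + t • v) hp
      (by rw [form_add_left, form_smul_left, hu, hv]; ring)
    simp only [form_add_left, form_add_right, form_smul_left, form_smul_right,
      N.form_comm v u] at h1
    linarith
  have := discrim_le_zero h
  rw [discrim] at this
  linarith

end Target

/-! ### Calculus of sections -/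

theorem contDiff_form (N : Target) {n : WithTop ℕ∞} {u v : Plane → Ambient} (hu : ContDiff ℝ n u)
    (hv : ContDiff ℝ n v) : ContDiff ℝ n fun y => N.form (u y) (v y) := by
  have hu' := contDiff_pi.mp hu
  have hv' := contDiff_pi.mp hv
  exact (((hu' 0).mul (hv' 0)).add ((hu' 1).mul (hv' 1))).add
    (contDiff_const.mul ((hu' 2).mul (hv' 2)))

theorem fderiv_form (N : Target) {u v : Plane → Ambient} {y : Plane}
    (hu : DifferentiableAt ℝ u y) (hv : DifferentiableAt ℝ v y) (w : Plane) :
    fderiv ℝ (fun x => N.form (u x) (v x)) y w =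
      N.form (fderiv ℝ u y w) (v y) + N.form (u y) (fderiv ℝ v y w) := by
  have hu' := hasFDerivAt_pi'.mp hu.hasFDerivAt
  have hv' := hasFDerivAt_pi'.mp hv.hasFDerivAt
  have h := (((hu' 0).mul (hv' 0)).add ((hu' 1).mul (hv' 1))).add
    (((hu' 2).mul (hv' 2)).const_mul N.curv)
  change fderiv ℝ (((fun x => u x 0) * (fun x => v x 0) + (fun x => u x 1) * (fun x => v x 1)) +
    fun x => N.curv * ((fun x => u x 2) * (fun x => v x 2)) x) y w = _
  rw [h.fderiv]
  simp [Target.form]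
  ring

theorem contDiff_proj (N : Target) {n : WithTop ℕ∞} {Q u : Plane → Ambient} (hQ : ContDiff ℝ n Q)
    (hu : ContDiff ℝ n u) : ContDiff ℝ n fun y => N.proj (Q y) (u y) :=
  hu.sub ((contDiff_const.mul (contDiff_form N hu hQ)).smul hQ)

theorem contDiff_covD (N : Target) {Q φ : Plane → Ambient} (hQ : ContDiff ℝ ∞ Q)
    (hφ : ContDiff ℝ ∞ φ) (v : Plane) : ContDiff ℝ ∞ fun y => covD N Q φ v y :=
  contDiff_proj N hQ ((hφ.fderiv_right (by simp)).clm_apply contDiff_const)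

theorem plane_eq (v : Plane) : v = v 0 • basisVec 0 + v 1 • basisVec 1 := by
  ext i; fin_cases i <;> simp

theorem covD_eq (N : Target) (Q φ : Plane → Ambient) (v y : Plane) :
    covD N Q φ v y = v 0 • covD N Q φ (basisVec 0) y + v 1 • covD N Q φ (basisVec 1) y := by
  conv_lhs => rw [plane_eq v]
  simp only [covD, map_add, map_smul, Target.proj_add, Target.proj_smul]

/-! ### Integration by parts and the Riemannian volume -/

theorem integrable_fderiv {f : Plane → ℝ} (hf : ContDiff ℝ 1 f) (hc : HasCompactSupport f)
    (v : Plane) : Integrable fun y => fderiv ℝ f y v :=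
  ((hf.continuous_fderiv (by simp)).clm_apply continuous_const).integrable_of_hasCompactSupport
      (hc.fderiv_apply (𝕜 := ℝ) v)

/-- The integral of a directional derivative of a compactly supported function vanishes. -/
theorem integral_fderiv_eq_zero {f : Plane → ℝ} (hf : ContDiff ℝ 1 f) (hc : HasCompactSupport f)
    (v : Plane) : ∫ y, fderiv ℝ f y v = 0 := by
  have h := integral_mul_fderiv_eq_neg_fderiv_mul_of_integrable (μ := (volume : Measure Plane))
    (f := fun _ : Plane => (1 : ℝ)) (g := f) (v := v)
    (by simp) (by simpa using integrable_fderiv hf hc v)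
    (by simpa using hf.continuous.integrable_of_hasCompactSupport hc)
    (fun x _ => differentiableAt_const _) (fun x _ => (hf.differentiable (by simp)) x)
  simpa using h

theorem vol_eq :
    vol = (volume : Measure Plane).withDensity fun y => ENNReal.ofReal (coshRadius y)⁻¹ := by
  simp only [vol, sqrt_det_metric]

theorem continuous_coshRadius_inv : Continuous fun y => (coshRadius y)⁻¹ :=
  contDiff_coshRadius.continuous.inv₀ fun y => (coshRadius_pos y).ne'

theorem integral_vol (f : Plane → ℝ) : ∫ y, f y ∂vol = ∫ y, (coshRadius y)⁻¹ * f y := by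
  rw [vol_eq, integral_withDensity_eq_integral_toReal_smul
    continuous_coshRadius_inv.measurable.ennreal_ofReal (by simp)]
  refine integral_congr_ae (Filter.Eventually.of_forall fun y => ?_)
  simp [(coshRadius_pos y).le]

theorem lintegral_vol {f : Plane → ℝ} (hf : Continuous f) (hc : HasCompactSupport f)
    (h0 : ∀ᵐ y : Plane, 0 ≤ f y) :
    ∫⁻ y, ENNReal.ofReal (f y) ∂vol = ENNReal.ofReal (∫ y, f y ∂vol) := by
  rw [integral_vol, vol_eq, lintegral_withDensity_eq_lintegral_mul _
    continuous_coshRadius_inv.measurable.ennreal_ofReal hf.measurable.ennreal_ofReal,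
    ofReal_integral_eq_lintegral_ofReal]
  · refine lintegral_congr fun y => ?_
    rw [Pi.mul_apply, ← ENNReal.ofReal_mul (inv_nonneg.mpr (coshRadius_pos y).le)]
  · exact (continuous_coshRadius_inv.mul hf).integrable_of_hasCompactSupport hc.mul_left
  · filter_upwards [h0] with y hy
    exact mul_nonneg (inv_nonneg.mpr (coshRadius_pos y).le) hy

theorem vol_absolutelyContinuous : vol ≪ (volume : Measure Plane) :=
  withDensity_absolutelyContinuous _ _

/-! ### The Hardy weight -/

/-- The logarithmic Hardy weight `p = (2 + log cosh r)⁻¹`. -/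
def hardyWeight (y : Plane) : ℝ := (2 + Real.log (coshRadius y))⁻¹

theorem log_coshRadius_nonneg (y : Plane) : 0 ≤ Real.log (coshRadius y) :=
  Real.log_nonneg (one_le_coshRadius y)

theorem hardyWeight_pos (y : Plane) : 0 < hardyWeight y :=
  inv_pos.mpr (by linarith [log_coshRadius_nonneg y])

/-- The reason for the constant `2` in the weight: `p ≤ 1/2` makes the coefficient `3/4 - p - p²/4`
of `1 / cosh² r` in the completed square nonnegative. -/
theorem hardyWeight_le_half (y : Plane) : hardyWeight y ≤ 1 / 2 := by
  rw [hardyWeight, one_div]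
  exact inv_anti₀ (by norm_num) (by linarith [log_coshRadius_nonneg y])

/-- From `log x ≤ x - 1`. It lets exponentially decaying quantities, namely `1 - tanh r` and the
energy density of the map, be absorbed by the weight. -/
theorem inv_le_hardyWeight (y : Plane) : (1 + coshRadius y)⁻¹ ≤ hardyWeight y :=
  inv_anti₀ (by linarith [log_coshRadius_nonneg y])
    (by linarith [Real.log_le_sub_one_of_pos (coshRadius_pos y)])

theorem contDiff_hardyWeight : ContDiff ℝ ∞ hardyWeight :=
  (contDiff_const.add (contDiff_coshRadius.log fun y => (coshRadius_pos y).ne')).inv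
    fun y => by linarith [log_coshRadius_nonneg y]

/-- In polar coordinates this is the Riccati equation `p' = -p² tanh r`, which produces the
remainder `p²/4`. -/
theorem fderiv_hardyWeight (y v : Plane) :
    fderiv ℝ hardyWeight y v =
      -(hardyWeight y) ^ 2 * (y 0 * v 0 + y 1 * v 1) / coshRadius y ^ 2 := by
  have hc := (coshRadius_pos y).ne'
  have h0 : (2 + Real.log (coshRadius y)) ≠ 0 := by linarith [log_coshRadius_nonneg y]
  have hd : DifferentiableAt ℝ coshRadius y := (hasFDerivAt_coshRadius y).differentiableAt
  have h := (hasDerivAt_inv h0).comp_hasFDerivAt y ((hd.hasFDerivAt.log hc).const_add 2)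
  change fderiv ℝ (Inv.inv ∘ fun x => 2 + Real.log (coshRadius x)) y v = _
  rw [h.fderiv]
  simp [fderiv_coshRadius, hardyWeight]
  field_simp

/-! ### The quadratic form up to divergences -/

/-- The curvature term `(R(Q)(φ, ∂_ℓ Q) ∂^ℓ Q, φ)`. -/
def curvTerm (N : Target) (Q φ : Plane → Ambient) (y : Plane) : ℝ :=
  ∑ j, ∑ k, invMetric y j k *
    N.form (N.curvOp (φ y) (fderiv ℝ Q y (basisVec j)) (fderiv ℝ Q y (basisVec k))) (φ y)

/-- The energy density `h^{jk} (D_j φ, D_k φ)`. -/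
def dirichletDensity (N : Target) (Q φ : Plane → Ambient) (y : Plane) : ℝ :=
  ∑ j, ∑ k, invMetric y j k * N.form (covD N Q φ (basisVec k) y) (covD N Q φ (basisVec j) y)

/-- The component `(D_k φ, φ)`. -/
def radialComp (N : Target) (φ : Plane → Ambient) (k : Fin 2) (y : Plane) : ℝ :=
  N.form (fderiv ℝ φ y (basisVec k)) (φ y)

/-- The flux `√h h^{jk} (D_k φ, φ)`. -/
def energyFlux (N : Target) (φ : Plane → Ambient) (j : Fin 2) (y : Plane) : ℝ :=
  (coshRadius y)⁻¹ * (radialComp N φ j y +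
    y j * (y 0 * radialComp N φ 0 y + y 1 * radialComp N φ 1 y))

/-- The flux of the vector field used to complete the square. -/
def hardyFlux (N : Target) (φ : Plane → Ambient) (j : Fin 2) (y : Plane) : ℝ :=
  (coshRadius y)⁻¹ * (1 / 2 * (1 - hardyWeight y) * y j * N.form (φ y) (φ y))

/-- The density of the quadratic form of `𝓗_Q - 1/4` after completing the square. -/
def stabilityDensity (N : Target) (Q φ : Plane → Ambient) (y : Plane) : ℝ :=
  dirichletDensity N Q φ y - curvTerm N Q φ y
    + (1 / 2 * (1 - hardyWeight y) * (2 - (y 0 ^ 2 + y 1 ^ 2) / coshRadius y ^ 2)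
        + 1 / 2 * hardyWeight y ^ 2 * (y 0 ^ 2 + y 1 ^ 2) / coshRadius y ^ 2 - 1 / 4)
      * N.form (φ y) (φ y)
    + (1 - hardyWeight y) * (y 0 * radialComp N φ 0 y + y 1 * radialComp N φ 1 y)

section

variable {N : Target} {Q φ : Plane → Ambient}

theorem IsTestSection.form_covD (hφ : IsTestSection N Q φ) (v y : Plane) :
    N.form (covD N Q φ v y) (φ y) = N.form (fderiv ℝ φ y v) (φ y) :=
  N.form_proj_left (hφ.tangent y) _

theorem contDiff_radialComp (hφ : ContDiff ℝ ∞ φ) (k : Fin 2) :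
    ContDiff ℝ ∞ (radialComp N φ k) :=
  contDiff_form N ((hφ.fderiv_right (by simp)).clm_apply contDiff_const) hφ

theorem contDiff_coshRadius_inv : ContDiff ℝ ∞ fun y => (coshRadius y)⁻¹ :=
  contDiff_coshRadius.inv fun y => (coshRadius_pos y).ne'

theorem contDiff_energyFlux (hφ : ContDiff ℝ ∞ φ) (j : Fin 2) :
    ContDiff ℝ ∞ (energyFlux N φ j) :=
  contDiff_coshRadius_inv.mul ((contDiff_radialComp hφ j).add ((contDiff_coord j).mul
    (((contDiff_coord 0).mul (contDiff_radialComp hφ 0)).add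
      ((contDiff_coord 1).mul (contDiff_radialComp hφ 1)))))

theorem contDiff_hardyFlux (hφ : ContDiff ℝ ∞ φ) (j : Fin 2) :
    ContDiff ℝ ∞ (hardyFlux N φ j) :=
  contDiff_coshRadius_inv.mul (((contDiff_const.mul (contDiff_const.sub contDiff_hardyWeight)).mul
    (contDiff_coord j)).mul (contDiff_form N hφ hφ))

theorem hasCompactSupport_of_eq_zero {f : Plane → ℝ} (hc : HasCompactSupport φ)
    (h : ∀ y, φ y = 0 → f y = 0) : HasCompactSupport f :=
  hc.mono' fun y hy => subset_tsupport _ fun h0 => hy (h y h0)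

theorem hasCompactSupport_energyFlux (hc : HasCompactSupport φ) (j : Fin 2) :
    HasCompactSupport (energyFlux N φ j) :=
  hasCompactSupport_of_eq_zero hc fun y h => by
    simp [energyFlux, radialComp, h, Target.form_zero_right]

theorem hasCompactSupport_hardyFlux (hc : HasCompactSupport φ) (j : Fin 2) :
    HasCompactSupport (hardyFlux N φ j) :=
  hasCompactSupport_of_eq_zero hc fun y h => by
    simp [hardyFlux, h, Target.form_zero_right]

theorem fderiv_hardyFlux (hφ : ContDiff ℝ ∞ φ) (j : Fin 2) (y : Plane) :
    fderiv ℝ (hardyFlux N φ j) y (basisVec j) = (coshRadius y)⁻¹ *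
      (1 / 2 * (1 - hardyWeight y) * (1 - y j ^ 2 / coshRadius y ^ 2) * N.form (φ y) (φ y)
        + 1 / 2 * hardyWeight y ^ 2 * y j ^ 2 / coshRadius y ^ 2 * N.form (φ y) (φ y)
        + (1 - hardyWeight y) * y j * radialComp N φ j y) := by
  have hc := (coshRadius_pos y).ne'
  have hp : HasFDerivAt hardyWeight _ y :=
    (contDiff_hardyWeight.differentiable (by simp) y).hasFDerivAt
  have hn : HasFDerivAt (fun x => N.form (φ x) (φ x)) _ y :=
    ((contDiff_form N hφ hφ).differentiable (by simp) y).hasFDerivAt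
  have hcd : HasFDerivAt coshRadius _ y :=
    (hasFDerivAt_coshRadius y).differentiableAt.hasFDerivAt
  have h := ((hasDerivAt_inv hc).comp_hasFDerivAt y hcd).mul
    ((((hp.const_sub 1).const_mul (1 / 2)).mul (hasFDerivAt_coord j y)).mul hn)
  have hφd : DifferentiableAt ℝ φ y := hφ.differentiable (by simp) y
  refine (DFunLike.congr_fun h.fderiv (basisVec j)).trans ?_
  simp only [_root_.add_apply, _root_.smul_apply,
    _root_.neg_apply, fderiv_hardyWeight, fderiv_coshRadius,
    fderiv_form N hφd hφd, Function.comp_apply, Pi.mul_apply, smul_eq_mul, radialComp,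
    N.form_comm (φ y) (fderiv ℝ φ y (basisVec j))]
  fin_cases j <;> simp <;> field_simp <;> ring

/-- Both sides are `√h Δ(|φ|²/2)`, in divergence form and in expanded form, with `√h = 1 / cosh r`.
-/
theorem fderiv_energyFlux (hφ : ContDiff ℝ ∞ φ) (y : Plane) :
    fderiv ℝ (energyFlux N φ 0) y (basisVec 0) + fderiv ℝ (energyFlux N φ 1) y (basisVec 1) =
      (coshRadius y)⁻¹ * ((∑ j, ∑ k, invMetric y j k *
          fderiv ℝ (radialComp N φ k) y (basisVec j)) +
        2 * (y 0 * radialComp N φ 0 y + y 1 * radialComp N φ 1 y)) := by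
  have hc := (coshRadius_pos y).ne'
  have ha : ∀ k, HasFDerivAt (radialComp N φ k) _ y := fun k =>
    ((contDiff_radialComp hφ k).differentiable (by simp) y).hasFDerivAt
  have hcd : HasFDerivAt coshRadius _ y :=
    (hasFDerivAt_coshRadius y).differentiableAt.hasFDerivAt
  have h : ∀ j, HasFDerivAt (energyFlux N φ j) _ y := fun j =>
    ((hasDerivAt_inv hc).comp_hasFDerivAt y hcd).mul
      ((ha j).add ((hasFDerivAt_coord j y).mul
        (((hasFDerivAt_coord 0 y).mul (ha 0)).add ((hasFDerivAt_coord 1 y).mul (ha 1)))))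
  rw [(h 0).fderiv, (h 1).fderiv]
  simp [fderiv_coshRadius, Fin.sum_univ_two, invMetric_eq]
  have h2 := coshRadius_sq y
  field_simp
  rw [h2]
  ring

/-- The Bochner identity: metric compatibility moves one derivative off `D² φ`, at the cost of
`Δ(|φ|²/2)`. Tangential projections may be inserted or dropped because `φ` and `D_k φ` are both
tangent. -/
theorem form_linOp (hQ : ContDiff ℝ ∞ Q) (hφ : IsTestSection N Q φ)
    (hS : ∀ y, Q y ∈ N.surface) (y : Plane) :
    N.form (linOp N Q φ y) (φ y) = dirichletDensity N Q φ y - curvTerm N Q φ y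
      - ((∑ j, ∑ k, invMetric y j k * fderiv ℝ (radialComp N φ k) y (basisVec j)) +
        2 * (y 0 * radialComp N φ 0 y + y 1 * radialComp N φ 1 y)) := by
  have hφd : DifferentiableAt ℝ φ y := hφ.smooth.differentiable (by simp) y
  have hD : ∀ k, radialComp N φ k = fun x => N.form (covD N Q φ (basisVec k) x) (φ x) :=
    fun k => funext fun x => (hφ.form_covD _ x).symm
  have hd : ∀ j k, fderiv ℝ (radialComp N φ k) y (basisVec j) =
      N.form (covD N Q (fun x => covD N Q φ (basisVec k) x) (basisVec j) y) (φ y) +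
        N.form (covD N Q φ (basisVec k) y) (covD N Q φ (basisVec j) y) := by
    intro j k
    rw [hD, fderiv_form N ((contDiff_covD N hQ hφ.smooth _).differentiable (by simp) y) hφd]
    congr 1
    · exact (N.form_proj_left (hφ.tangent y) _).symm
    · rw [N.form_comm, N.form_comm (covD N Q φ (basisVec k) y)]
      exact (N.form_proj_left (N.form_proj_self (N.form_self_of_mem (hS y)) _) _).symm
  have h0 := contracted_christoffel 0 y
  have h1 := contracted_christoffel 1 y
  have ha : ∀ k, N.form (covD N Q φ (basisVec k) y) (φ y) = radialComp N φ k y :=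
    fun k => hφ.form_covD _ y
  simp only [Fin.sum_univ_two] at h0 h1
  simp only [linOp, covD2, dirichletDensity, curvTerm, hd, Fin.sum_univ_two,
    Target.form_sub_left, Target.form_neg_left, Target.form_add_left, Target.form_smul_left, ha]
  linear_combination radialComp N φ 0 y * h0 + radialComp N φ 1 y * h1

theorem contDiff_invMetric (j k : Fin 2) : ContDiff ℝ ∞ fun y => invMetric y j k := by
  simp only [invMetric_eq]
  have h0 := contDiff_coord 0
  have h1 := contDiff_coord 1
  fin_cases j <;> fin_cases k
  · exact contDiff_const.add (h0.pow 2)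
  · exact h0.mul h1
  · exact h0.mul h1
  · exact contDiff_const.add (h1.pow 2)

theorem continuous_dirichletDensity (hQ : ContDiff ℝ ∞ Q) (hφ : ContDiff ℝ ∞ φ) :
    Continuous (dirichletDensity N Q φ) :=
  continuous_finsetSum _ fun j _ => continuous_finsetSum _ fun k _ =>
    (contDiff_invMetric j k).continuous.mul
      (contDiff_form N (contDiff_covD N hQ hφ _) (contDiff_covD N hQ hφ _)).continuous

theorem continuous_curvTerm (hQ : ContDiff ℝ ∞ Q) (hφ : ContDiff ℝ ∞ φ) :
    Continuous (curvTerm N Q φ) := by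
  have hd : ∀ j, ContDiff ℝ ∞ fun y => fderiv ℝ Q y (basisVec j) := fun j =>
    (hQ.fderiv_right (by simp)).clm_apply contDiff_const
  refine continuous_finsetSum _ fun j _ => continuous_finsetSum _ fun k _ =>
    (contDiff_invMetric j k).continuous.mul (contDiff_form N ?_ hφ).continuous
  exact (contDiff_const (c := N.curv)).smul (((contDiff_form N (hd j) (hd k)).smul hφ).sub
    ((contDiff_form N hφ (hd k)).smul (hd j)))

theorem covD_eq_zero_of_notMem (v : Plane) {y : Plane} (hy : y ∉ tsupport φ) :
    covD N Q φ v y = 0 := by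
  have : fderiv ℝ φ y = 0 := by
    by_contra h
    exact hy (support_fderiv_subset ℝ h)
  simp [covD, this, Target.proj, Target.form_zero_left]

theorem hasCompactSupport_stabilityDensity (hc : HasCompactSupport φ) :
    HasCompactSupport (stabilityDensity N Q φ) := by
  refine HasCompactSupport.intro hc fun y hy => ?_
  have h0 : φ y = 0 := image_eq_zero_of_notMem_tsupport hy
  simp [stabilityDensity, dirichletDensity, curvTerm, radialComp, h0, covD_eq_zero_of_notMem _ hy,
    Target.form_zero_right]

theorem continuous_stabilityDensity (hQ : ContDiff ℝ ∞ Q) (hφ : ContDiff ℝ ∞ φ) :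
    Continuous (stabilityDensity N Q φ) := by
  have h1 := contDiff_hardyWeight.continuous
  have h2 := contDiff_coshRadius.continuous
  have h3 := fun k => (contDiff_radialComp (N := N) hφ k).continuous
  have h4 := (contDiff_form N hφ hφ).continuous
  have h5 := fun j => (contDiff_coord j).continuous
  have h6 : ∀ y, coshRadius y ^ 2 ≠ 0 := fun y => pow_ne_zero 2 (coshRadius_pos y).ne'
  have h7 : Continuous fun y : Plane => (y 0 ^ 2 + y 1 ^ 2) / coshRadius y ^ 2 :=
    (((h5 0).pow 2).add ((h5 1).pow 2)).div (h2.pow 2) h6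
  have h8 : Continuous fun y : Plane =>
      1 / 2 * hardyWeight y ^ 2 * (y 0 ^ 2 + y 1 ^ 2) / coshRadius y ^ 2 :=
    ((continuous_const.mul (h1.pow 2)).mul (((h5 0).pow 2).add ((h5 1).pow 2))).div (h2.pow 2) h6
  exact (((continuous_dirichletDensity hQ hφ).sub (continuous_curvTerm hQ hφ)).add
    (((((continuous_const.mul (continuous_const.sub h1)).mul (continuous_const.sub h7)).add
      h8).sub continuous_const).mul h4)).add
    ((continuous_const.sub h1).mul (((h5 0).mul (h3 0)).add ((h5 1).mul (h3 1))))

/-- The factor `1 / cosh r` is the volume density, so the correction is a sum of plain coordinate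
derivatives and integrates to zero by compact support. -/
theorem form_linOp_eq_stabilityDensity (hQ : ContDiff ℝ ∞ Q) (hφ : IsTestSection N Q φ)
    (hS : ∀ y, Q y ∈ N.surface) (y : Plane) :
    (coshRadius y)⁻¹ * (N.form (linOp N Q φ y) (φ y) - 1 / 4 * N.form (φ y) (φ y)) =
      (coshRadius y)⁻¹ * stabilityDensity N Q φ y
        - ∑ j, (fderiv ℝ (energyFlux N φ j) y (basisVec j)
          + fderiv ℝ (hardyFlux N φ j) y (basisVec j)) := by
  have h := fderiv_energyFlux (N := N) hφ.smooth y
  rw [Fin.sum_univ_two, fderiv_hardyFlux hφ.smooth, fderiv_hardyFlux hφ.smooth,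
    form_linOp hQ hφ hS, stabilityDensity]
  linear_combination h

theorem integrable_flux (hφ : IsTestSection N Q φ) :
    Integrable (fun y => ∑ j, (fderiv ℝ (energyFlux N φ j) y (basisVec j)
      + fderiv ℝ (hardyFlux N φ j) y (basisVec j))) :=
  integrable_finsetSum _ fun j _ =>
    (integrable_fderiv ((contDiff_energyFlux hφ.smooth j).of_le (by simp))
      (hasCompactSupport_energyFlux hφ.compact j) _).add
    (integrable_fderiv ((contDiff_hardyFlux hφ.smooth j).of_le (by simp))
      (hasCompactSupport_hardyFlux hφ.compact j) _)

theorem integral_flux (hφ : IsTestSection N Q φ) :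
    ∫ y, ∑ j, (fderiv ℝ (energyFlux N φ j) y (basisVec j)
      + fderiv ℝ (hardyFlux N φ j) y (basisVec j)) = 0 := by
  have he := fun j => (contDiff_energyFlux (N := N) hφ.smooth j).of_le (m := 1) (by simp)
  have hh := fun j => (contDiff_hardyFlux (N := N) hφ.smooth j).of_le (m := 1) (by simp)
  have he' := fun j => hasCompactSupport_energyFlux (N := N) hφ.compact j
  have hh' := fun j => hasCompactSupport_hardyFlux (N := N) hφ.compact j
  refine (integral_finsetSum _ fun j _ => (integrable_fderiv (he j) (he' j) (basisVec j)).add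
    (integrable_fderiv (hh j) (hh' j) (basisVec j))).trans (Finset.sum_eq_zero fun j _ => ?_)
  simp only [Pi.add_apply]
  rw [integral_add (integrable_fderiv (he j) (he' j) _) (integrable_fderiv (hh j) (hh' j) _),
    integral_fderiv_eq_zero (he j) (he' j), integral_fderiv_eq_zero (hh j) (hh' j), add_zero]

theorem integrable_stabilityDensity (hQ : ContDiff ℝ ∞ Q) (hφ : IsTestSection N Q φ) :
    Integrable fun y => (coshRadius y)⁻¹ * stabilityDensity N Q φ y :=
  (continuous_coshRadius_inv.mul
    (continuous_stabilityDensity hQ hφ.smooth)).integrable_of_hasCompactSupport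
    (hasCompactSupport_stabilityDensity hφ.compact).mul_left

/-- The pairing of `(1/4 - 𝓗_Q) φ` with `φ`, after completing the square. -/
theorem pairing_sub_linOp (hQ : ContDiff ℝ ∞ Q) (hφ : IsTestSection N Q φ)
    (hS : ∀ y, Q y ∈ N.surface) :
    pairing N (fun y => (1 / 4 : ℝ) • φ y - linOp N Q φ y) φ =
      -∫ y, stabilityDensity N Q φ y ∂vol := by
  rw [pairing, integral_vol, integral_vol, ← sub_zero (∫ y, _ * stabilityDensity N Q φ y),
    ← integral_flux hφ, ← integral_sub (integrable_stabilityDensity hQ hφ) (integrable_flux hφ),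
    ← integral_neg]
  refine integral_congr_ae (Filter.Eventually.of_forall fun y => ?_)
  dsimp only
  rw [← form_linOp_eq_stabilityDensity hQ hφ hS, N.form_sub_left, N.form_smul_left]
  ring

/-- The quadratic form of `𝓗_Q - 1/4` after completing the square. -/
theorem pairing_linOp_sub (hQ : ContDiff ℝ ∞ Q) (hφ : IsTestSection N Q φ)
    (hS : ∀ y, Q y ∈ N.surface) :
    pairing N (linOp N Q φ) φ - 1 / 4 * pairing N φ φ = ∫ y, stabilityDensity N Q φ y ∂vol := by
  have hn : Integrable fun y => (coshRadius y)⁻¹ * N.form (φ y) (φ y) :=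
    (continuous_coshRadius_inv.mul
      (contDiff_form N hφ.smooth hφ.smooth).continuous).integrable_of_hasCompactSupport
      (HasCompactSupport.mul_left (hasCompactSupport_of_eq_zero hφ.compact fun y h => by
        rw [h, N.form_zero_left]))
  have hi : Integrable fun y => (coshRadius y)⁻¹ * stabilityDensity N Q φ y -
      ∑ j, (fderiv ℝ (energyFlux N φ j) y (basisVec j)
        + fderiv ℝ (hardyFlux N φ j) y (basisVec j)) :=
    (integrable_stabilityDensity hQ hφ).sub (integrable_flux hφ)
  have h : pairing N (linOp N Q φ) φ = ∫ y, (((coshRadius y)⁻¹ * stabilityDensity N Q φ y -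
      ∑ j, (fderiv ℝ (energyFlux N φ j) y (basisVec j)
        + fderiv ℝ (hardyFlux N φ j) y (basisVec j))) +
      1 / 4 * ((coshRadius y)⁻¹ * N.form (φ y) (φ y))) := by
    rw [pairing, integral_vol]
    refine integral_congr_ae (Filter.Eventually.of_forall fun y => ?_)
    dsimp only
    rw [← form_linOp_eq_stabilityDensity hQ hφ hS]
    ring
  rw [h, integral_add hi (hn.const_mul _),
    integral_sub (integrable_stabilityDensity hQ hφ) (integrable_flux hφ), integral_flux hφ,
    integral_const_mul, pairing, integral_vol, integral_vol]
  ring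

end

/-! ### Completing the square and coercivity -/

theorem form_covD_base {N : Target} {Q : Plane → Ambient} (hS : ∀ y, Q y ∈ N.surface)
    (φ : Plane → Ambient) (v y : Plane) : N.form (covD N Q φ v y) (Q y) = 0 :=
  N.form_proj_self (N.form_self_of_mem (hS y)) _

/-- The coefficient `b` completing the square: `(1/2) tanh r (1 - p)`. -/
def squareCoeff (y : Plane) : ℝ := 1 / 2 * (‖y‖ / coshRadius y) * (1 - hardyWeight y)

/-- The field of the Hardy flux is `b ∂_r`, since `y^j ∂_j = tanh r ∂_r`. Its divergence gives `2 b
(D_r φ, φ) + (b' + b coth r) |φ|²`; the cross term completes the square and leaves the potential `b'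
+ b coth r - b² - 1/4`, evaluated with `p' = -p² tanh r`. -/
theorem stabilityDensity_eq {N : Target} {Q φ : Plane → Ambient} (hφ : IsTestSection N Q φ)
    {y : Plane} (hy : y ≠ 0) :
    stabilityDensity N Q φ y =
      N.form (covD N Q φ (radialVec y) y + squareCoeff y • φ y)
          (covD N Q φ (radialVec y) y + squareCoeff y • φ y)
        + N.form (covD N Q φ (angularVec y) y) (covD N Q φ (angularVec y) y)
        + (1 / 4 * hardyWeight y ^ 2 + (3 / 4 - hardyWeight y - 1 / 4 * hardyWeight y ^ 2)
          / coshRadius y ^ 2) * N.form (φ y) (φ y)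
        - curvTerm N Q φ y := by
  have hn : ‖y‖ ≠ 0 := norm_ne_zero_iff.mpr hy
  have hc := (coshRadius_pos y).ne'
  have h1 := norm_sq_plane y
  have h2 : coshRadius y ^ 2 = 1 + ‖y‖ ^ 2 := by rw [coshRadius_sq, h1]; ring
  have hr : ∀ i, radialVec y i = coshRadius y / ‖y‖ * y i := fun i => rfl
  have ha0 : angularVec y 0 = ‖y‖⁻¹ * -(y 1) := rfl
  have ha1 : angularVec y 1 = ‖y‖⁻¹ * y 0 := rfl
  have hd : ∀ k, N.form (covD N Q φ (basisVec k) y) (φ y) = radialComp N φ k y :=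
    fun k => hφ.form_covD _ y
  rw [covD_eq N Q φ (radialVec y), covD_eq N Q φ (angularVec y)]
  simp only [stabilityDensity, dirichletDensity, Fin.sum_univ_two, invMetric_eq, hr, ha0, ha1,
    Target.form_add_left, Target.form_add_right, Target.form_smul_left, Target.form_smul_right,
    hd, N.form_comm (φ y) (covD N Q φ _ y),
    N.form_comm (covD N Q φ (basisVec 1) y) (covD N Q φ (basisVec 0) y), squareCoeff]
  generalize N.form (covD N Q φ (basisVec 0) y) (covD N Q φ (basisVec 0) y) = A
  generalize N.form (covD N Q φ (basisVec 0) y) (covD N Q φ (basisVec 1) y) = B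
  generalize N.form (covD N Q φ (basisVec 1) y) (covD N Q φ (basisVec 1) y) = C
  generalize N.form (φ y) (φ y) = D
  generalize radialComp N φ 0 y = a0
  generalize radialComp N φ 1 y = a1
  generalize hardyWeight y = p
  generalize curvTerm N Q φ y = K
  simp
  rw [← h1]
  field_simp
  simp only [h2, h1]
  ring

theorem log_coshRadius_le_radius (y : Plane) : Real.log (coshRadius y) ≤ radius y := by
  rw [radius, Real.arsinh]
  refine Real.log_le_log (coshRadius_pos y) ?_
  rw [coshRadius]
  linarith [norm_nonneg y]

theorem inv_one_add_radius_sq_le (y : Plane) : (1 + radius y ^ 2)⁻¹ ≤ 5 * hardyWeight y ^ 2 := by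
  have h := log_coshRadius_le_radius y
  have h0 := log_coshRadius_nonneg y
  rw [hardyWeight, inv_pow, ← div_eq_mul_inv, inv_eq_one_div,
    div_le_div_iff₀ (by positivity) (by positivity)]
  -- `(2 + r)² ≤ 5 (1 + r²)` amounts to `(2 r - 1)² ≥ 0`.
  nlinarith [sq_nonneg (2 * radius y - 1)]

theorem norm_div_coshRadius_le_one (y : Plane) : ‖y‖ / coshRadius y ≤ 1 := by
  rw [div_le_one (coshRadius_pos y), coshRadius]
  exact Real.le_sqrt_of_sq_le (by linarith)

theorem one_sub_norm_div_le (y : Plane) : 1 - ‖y‖ / coshRadius y ≤ 2 * hardyWeight y := by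
  have hc := coshRadius_pos y
  have hc1 := one_le_coshRadius y
  have hn := norm_nonneg y
  have h2 : coshRadius y ^ 2 = 1 + ‖y‖ ^ 2 := by rw [coshRadius_sq, norm_sq_plane]; ring
  have h1 : 1 - ‖y‖ / coshRadius y ≤ 2 * (1 + coshRadius y)⁻¹ := by
    rw [one_sub_div hc.ne', ← div_eq_mul_inv, div_le_div_iff₀ hc (by positivity)]
    nlinarith
  linarith [inv_le_hardyWeight y]

theorem sq_half_sub_squareCoeff_le (y : Plane) :
    (1 / 2 - squareCoeff y) ^ 2 ≤ 9 / 4 * hardyWeight y ^ 2 := by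
  have h1 := norm_div_coshRadius_le_one y
  have h2 := one_sub_norm_div_le y
  have h3 : 0 ≤ ‖y‖ / coshRadius y := div_nonneg (norm_nonneg y) (coshRadius_pos y).le
  have hp := hardyWeight_pos y
  -- `1/2 - b = (1 - tanh r)/2 + (p tanh r)/2`, and the two parts are at most `p` and `p/2`.
  have h4 : 0 ≤ 1 / 2 - squareCoeff y := by rw [squareCoeff]; nlinarith [mul_nonneg h3 hp.le]
  have h5 : 1 / 2 - squareCoeff y ≤ 3 / 2 * hardyWeight y := by
    rw [squareCoeff]; nlinarith [mul_le_mul_of_nonneg_right h1 hp.le]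
  calc (1 / 2 - squareCoeff y) ^ 2 ≤ (3 / 2 * hardyWeight y) ^ 2 := pow_le_pow_left₀ h4 h5 2
    _ = _ := by ring

section

variable {N : Target} {Q φ : Plane → Ambient}

/-- Pointwise lower bound of the density, under a smallness condition on the curvature term. -/
theorem le_stabilityDensity (hS : ∀ y, Q y ∈ N.surface) (hφ : IsTestSection N Q φ) {y : Plane}
    (hK : curvTerm N Q φ y ≤ 1 / 8 * hardyWeight y ^ 2 * N.form (φ y) (φ y)) (hy : y ≠ 0) :
    N.form (covD N Q φ (radialVec y) y + squareCoeff y • φ y)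
        (covD N Q φ (radialVec y) y + squareCoeff y • φ y)
      + N.form (covD N Q φ (angularVec y) y) (covD N Q φ (angularVec y) y)
      + 1 / 8 * hardyWeight y ^ 2 * N.form (φ y) (φ y) ≤ stabilityDensity N Q φ y := by
  rw [stabilityDensity_eq hφ hy]
  have hp := hardyWeight_pos y
  have hp2 := hardyWeight_le_half y
  have h0 : 0 ≤ (3 / 4 - hardyWeight y - 1 / 4 * hardyWeight y ^ 2) / coshRadius y ^ 2 :=
    div_nonneg (by nlinarith) (sq_nonneg _)
  have := mul_nonneg h0 (N.form_self_nonneg (hS y) (hφ.tangent y))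
  linarith

/-- The three densities of the threshold norm are controlled by the stability density. -/
theorem thresholdDensities_le (hS : ∀ y, Q y ∈ N.surface) (hφ : IsTestSection N Q φ) {y : Plane}
    (hK : curvTerm N Q φ y ≤ 1 / 8 * hardyWeight y ^ 2 * N.form (φ y) (φ y)) (hy : y ≠ 0) :
    0 ≤ stabilityDensity N Q φ y ∧
    N.form (covD N Q φ (radialVec y) y + (1 / 2 : ℝ) • φ y)
        (covD N Q φ (radialVec y) y + (1 / 2 : ℝ) • φ y) ≤ 40 * stabilityDensity N Q φ y ∧
    N.form (covD N Q φ (angularVec y) y) (covD N Q φ (angularVec y) y) ≤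
      40 * stabilityDensity N Q φ y ∧
    N.form ((Real.sqrt (1 + radius y ^ 2))⁻¹ • φ y) ((Real.sqrt (1 + radius y ^ 2))⁻¹ • φ y) ≤
      40 * stabilityDensity N Q φ y := by
  have h := le_stabilityDensity hS hφ hK hy
  have hr := form_covD_base hS φ (radialVec y) y
  have hφ0 := hφ.tangent y
  have hn := N.form_self_nonneg (hS y) hφ0
  have hB : 0 ≤ N.form (covD N Q φ (radialVec y) y + squareCoeff y • φ y)
        (covD N Q φ (radialVec y) y + squareCoeff y • φ y) :=
    N.form_self_nonneg (hS y) (by rw [N.form_add_left, N.form_smul_left, hr, hφ0]; ring)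
  have hΘ := N.form_self_nonneg (hS y) (form_covD_base hS φ (angularVec y) y)
  have hp : 0 ≤ hardyWeight y ^ 2 * N.form (φ y) (φ y) := mul_nonneg (sq_nonneg _) hn
  have hA : 0 ≤ N.form
      (covD N Q φ (radialVec y) y + squareCoeff y • φ y - (1 / 2 - squareCoeff y) • φ y)
      (covD N Q φ (radialVec y) y + squareCoeff y • φ y - (1 / 2 - squareCoeff y) • φ y) :=
    N.form_self_nonneg (hS y) (by
      simp only [N.form_sub_left, N.form_add_left, N.form_smul_left, hr, hφ0]; ring)
  -- The constant `40` comes from the weighted term, as `5 p² = 40 · p²/8`. The radial term needs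
  -- only `36`: by `|u + v|² ≤ 2|u|² + 2|v|²`, which is `hA`, it costs `2 · (9/4) p² = 36 · p²/8`.
  refine ⟨by linarith, ?_, by linarith, ?_⟩
  · have hb := mul_le_mul_of_nonneg_right (sq_half_sub_squareCoeff_le y) hn
    simp only [Target.form_sub_left, Target.form_sub_right, Target.form_add_left,
      Target.form_add_right, Target.form_smul_left, Target.form_smul_right,
      N.form_comm (φ y) (covD N Q φ _ y)] at *
    linarith
  · have h1 := mul_le_mul_of_nonneg_right (inv_one_add_radius_sq_le y) hn
    rw [N.form_smul_left, N.form_smul_right, ← mul_assoc, ← mul_inv,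
      Real.mul_self_sqrt (by positivity)]
    linarith

theorem normL2_le_of_density {e : Plane → ℝ} (he : Continuous e) (hc : HasCompactSupport e)
    (h0 : ∀ᵐ y : Plane, 0 ≤ e y) {ψ : Plane → Ambient}
    (h : ∀ᵐ y : Plane, N.form (ψ y) (ψ y) ≤ 40 * e y) :
    normL2 N ψ ≤ ENNReal.ofReal (Real.sqrt (40 * ∫ y, e y ∂vol)) := by
  have h1 : ∫⁻ y, ENNReal.ofReal (N.form (ψ y) (ψ y)) ∂vol ≤
      ENNReal.ofReal (40 * ∫ y, e y ∂vol) := by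
    rw [← integral_const_mul, ← lintegral_vol (f := fun y => 40 * e y)
      (continuous_const.mul he) hc.mul_left (by filter_upwards [h0] with y hy; linarith)]
    refine lintegral_mono_ae (vol_absolutelyContinuous.ae_le ?_)
    filter_upwards [h] with y hy
    exact ENNReal.ofReal_le_ofReal hy
  rw [normL2, Real.sqrt_eq_rpow]
  refine (ENNReal.rpow_le_rpow h1 (by norm_num)).trans_eq
    (ENNReal.ofReal_rpow_of_nonneg ?_ (by norm_num))
  exact mul_nonneg (by norm_num) (integral_nonneg_of_ae (vol_absolutelyContinuous.ae_le h0))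

/-- Coercivity of the quadratic form of `𝓗_Q - 1/4` with respect to the threshold norm. -/
theorem normThr_le (hQ : ContDiff ℝ ∞ Q) (hS : ∀ y, Q y ∈ N.surface) (hφ : IsTestSection N Q φ)
    (hK : ∀ y, curvTerm N Q φ y ≤ 1 / 8 * hardyWeight y ^ 2 * N.form (φ y) (φ y)) :
    0 ≤ ∫ y, stabilityDensity N Q φ y ∂vol ∧
    normThr N Q φ ≤ ENNReal.ofReal (3 * Real.sqrt (40 * ∫ y, stabilityDensity N Q φ y ∂vol)) := by
  -- The polar frame degenerates at the origin, a null set.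
  have hae : ∀ᵐ y : Plane, y ≠ 0 := by simp [ae_iff]
  have hall : ∀ᵐ y : Plane, _ := hae.mono fun y hy => thresholdDensities_le hS hφ (hK y) hy
  have h0 := hall.mono fun y h => h.1
  have he := continuous_stabilityDensity (N := N) hQ hφ.smooth
  have hc := hasCompactSupport_stabilityDensity (N := N) (Q := Q) hφ.compact
  refine ⟨integral_nonneg_of_ae (vol_absolutelyContinuous.ae_le h0), ?_⟩
  have hs := Real.sqrt_nonneg (40 * ∫ y, stabilityDensity N Q φ y ∂vol)
  refine (add_le_add (add_le_add
    (normL2_le_of_density he hc h0 (hall.mono fun y h => h.2.1))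
    (normL2_le_of_density he hc h0 (hall.mono fun y h => h.2.2.1)))
    (normL2_le_of_density he hc h0 (hall.mono fun y h => h.2.2.2))).trans_eq ?_
  rw [← ENNReal.ofReal_add hs hs, ← ENNReal.ofReal_add (by positivity) hs]
  congr 1
  ring

/-! ### Homogeneity and duality of the threshold norms -/

theorem normL2_smul (a : ℝ) (ψ : Plane → Ambient) :
    normL2 N (fun y => a • ψ y) = ENNReal.ofReal |a| * normL2 N ψ := by
  simp only [normL2, N.form_smul_left, N.form_smul_right, ← mul_assoc, ← pow_two]
  simp only [ENNReal.ofReal_mul (sq_nonneg a)]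
  rw [lintegral_const_mul' _ _ ENNReal.ofReal_ne_top,
    ENNReal.mul_rpow_of_nonneg _ _ (by norm_num), ← sq_abs,
    ENNReal.ofReal_rpow_of_nonneg (by positivity) (by norm_num), ← Real.sqrt_eq_rpow,
    Real.sqrt_sq (abs_nonneg a)]

theorem covD_smul (hφ : ContDiff ℝ ∞ φ) (a : ℝ) (v y : Plane) :
    covD N Q (fun x => a • φ x) v y = a • covD N Q φ v y := by
  have h : HasFDerivAt (fun x => a • φ x) (a • fderiv ℝ φ y) y :=
    (hφ.differentiable (by simp) y).hasFDerivAt.const_smul a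
  rw [covD, h.fderiv, _root_.smul_apply, N.proj_smul, covD]

theorem normThr_smul (hφ : ContDiff ℝ ∞ φ) (a : ℝ) :
    normThr N Q (fun y => a • φ y) = ENNReal.ofReal |a| * normThr N Q φ := by
  rw [normThr, normThr, mul_add, mul_add, ← normL2_smul, ← normL2_smul, ← normL2_smul]
  simp only [covD_smul hφ, smul_add, smul_comm a]

theorem IsTestSection.smul (hφ : IsTestSection N Q φ) (a : ℝ) :
    IsTestSection N Q (fun y => a • φ y) where
  smooth := hφ.smooth.const_smul a
  compact := hφ.compact.mono fun y hy h => hy (by simp [h])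
  tangent y := by rw [N.form_smul_left, hφ.tangent y, mul_zero]

theorem pairing_smul_right (f : Plane → Ambient) (a : ℝ) (χ : Plane → Ambient) :
    pairing N f (fun y => a • χ y) = a * pairing N f χ := by
  simp only [pairing, N.form_smul_right, integral_const_mul]

/-- The duality estimate `|(f, φ)| ≤ ‖f‖ ‖φ‖`. -/
theorem abs_pairing_le (hφ : IsTestSection N Q φ) (f : Plane → Ambient)
    (h0 : normThr N Q φ ≠ 0) (ht : normThr N Q φ ≠ ⊤) :
    ENNReal.ofReal |pairing N f φ| ≤ normThr N Q φ * normThrDual N Q f := by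
  set M := normThr N Q φ with hM
  have hpos : 0 < M.toReal := ENNReal.toReal_pos h0 ht
  have hnorm : normThr N Q (fun y => M.toReal⁻¹ • φ y) ≤ 1 := by
    rw [normThr_smul hφ.smooth, abs_of_pos (inv_pos.mpr hpos), ENNReal.ofReal_inv_of_pos hpos,
      ENNReal.ofReal_toReal ht, ← hM, ENNReal.inv_mul_cancel h0 ht]
  have h1 : ENNReal.ofReal |pairing N f (fun y => M.toReal⁻¹ • φ y)| ≤ normThrDual N Q f :=
    le_iSup_of_le _ (le_iSup_of_le (hφ.smul _) (le_iSup_of_le hnorm le_rfl))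
  calc ENNReal.ofReal |pairing N f φ|
      = M * ENNReal.ofReal |pairing N f (fun y => M.toReal⁻¹ • φ y)| := by
        rw [pairing_smul_right, abs_mul, abs_of_pos (inv_pos.mpr hpos),
          ENNReal.ofReal_mul (inv_pos.mpr hpos).le, ENNReal.ofReal_inv_of_pos hpos,
          ENNReal.ofReal_toReal ht, ← mul_assoc, ENNReal.mul_inv_cancel h0 ht, one_mul]
    _ ≤ _ := by gcongr

/-- Smallness of the curvature term implies strong linearized stability. -/
theorem stronglyStable_of_curvTerm_le (hQ : ContDiff ℝ ∞ Q) (hS : ∀ y, Q y ∈ N.surface)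
    (hK : ∀ φ, IsTestSection N Q φ →
      ∀ y, curvTerm N Q φ y ≤ 1 / 8 * hardyWeight y ^ 2 * N.form (φ y) (φ y)) :
    StronglyStable N Q where
  no_eigenvalue φ hφ := by
    linarith [pairing_linOp_sub hQ hφ hS, (normThr_le hQ hS hφ (hK φ hφ)).1]
  no_resonance := by
    -- `360 = 3² · 40`: three summands in the threshold norm, each with square at most `40` times
    -- the form.
    refine ⟨360, by norm_num, fun φ hφ => ?_⟩
    obtain ⟨hE, hle⟩ := normThr_le hQ hS hφ (hK φ hφ)
    have ht : normThr N Q φ ≠ ⊤ := ne_top_of_le_ne_top ENNReal.ofReal_ne_top hle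
    rcases eq_or_ne (normThr N Q φ) 0 with h0 | h0
    · simp [h0]
    have hd := abs_pairing_le hφ (fun y => (1 / 4 : ℝ) • φ y - linOp N Q φ y) h0 ht
    rw [pairing_sub_linOp hQ hφ hS, abs_neg, abs_of_nonneg hE] at hd
    refine (ENNReal.mul_le_mul_iff_right h0 ht).mp ?_
    calc normThr N Q φ * normThr N Q φ
        ≤ ENNReal.ofReal (3 * Real.sqrt (40 * ∫ y, stabilityDensity N Q φ y ∂vol)) *
          ENNReal.ofReal (3 * Real.sqrt (40 * ∫ y, stabilityDensity N Q φ y ∂vol)) := by gcongr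
      _ = ENNReal.ofReal 360 * ENNReal.ofReal (∫ y, stabilityDensity N Q φ y ∂vol) := by
        rw [← ENNReal.ofReal_mul (by positivity), ← ENNReal.ofReal_mul (by norm_num)]
        congr 1
        have := Real.mul_self_sqrt (mul_nonneg (by norm_num : (0 : ℝ) ≤ 40) hE)
        linear_combination 9 * this
      _ ≤ ENNReal.ofReal 360 * (normThr N Q φ *
          normThrDual N Q fun y => (1 / 4 : ℝ) • φ y - linOp N Q φ y) := by gcongr
      _ = _ := by ring

end

/-! ### Algebraic form and smoothness of the harmonic maps -/

theorem tanh_half (r : ℝ) : Real.tanh (r / 2) = Real.sinh r / (1 + Real.cosh r) := by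
  have hc := Real.cosh_pos (r / 2)
  have h1 : Real.sinh r = 2 * Real.sinh (r / 2) * Real.cosh (r / 2) := by
    rw [← Real.sinh_two_mul]; congr 1; ring
  have h2 : Real.cosh r = Real.cosh (r / 2) ^ 2 + Real.sinh (r / 2) ^ 2 := by
    rw [← Real.cosh_two_mul]; congr 1; ring
  have h3 := Real.cosh_sq (r / 2)
  have h4 : 1 + Real.cosh r = 2 * Real.cosh (r / 2) ^ 2 := by linarith
  rw [Real.tanh_eq_sinh_div_cosh, h4, h1]
  field_simp

theorem tanh_half_radius (y : Plane) :
    Real.tanh (radius y / 2) = ‖y‖ / (1 + coshRadius y) := by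
  rw [tanh_half, radius, Real.sinh_arsinh, Real.cosh_arsinh, coshRadius]

theorem Target.S_profile (N : Target) {lam r : ℝ}
    (h : N = .hyperbolic → |lam * Real.tanh (r / 2)| < 1) :
    N.S (N.profile lam r) =
      2 * (lam * Real.tanh (r / 2)) / (1 + N.curv * (lam * Real.tanh (r / 2)) ^ 2) := by
  cases N
  · generalize hx : lam * Real.tanh (r / 2) = x
    simp only [S, profile, curv, Real.sin_two_mul, Real.sin_arctan, Real.cos_arctan, hx]
    have := Real.mul_self_sqrt (by positivity : 0 ≤ 1 + x ^ 2)
    have h0 : Real.sqrt (1 + x ^ 2) ≠ 0 := (Real.sqrt_pos.mpr (by positivity)).ne'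
    rw [one_mul, mul_assoc, div_mul_div_comm, this, mul_one, mul_div_assoc]
  · have h := abs_lt.mp (h rfl)
    generalize hx : lam * Real.tanh (r / 2) = x at *
    have hp : 0 < 1 - x ^ 2 := by nlinarith
    simp only [S, profile, curv, Real.sinh_two_mul, Real.sinh_artanh h, Real.cosh_artanh h, hx]
    have := Real.mul_self_sqrt hp.le
    rw [mul_assoc, div_mul_div_comm, this, mul_one, mul_div_assoc]
    ring

theorem Target.S'_profile (N : Target) {lam r : ℝ}
    (h : N = .hyperbolic → |lam * Real.tanh (r / 2)| < 1) :
    N.S' (N.profile lam r) =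
      (1 - N.curv * (lam * Real.tanh (r / 2)) ^ 2) /
        (1 + N.curv * (lam * Real.tanh (r / 2)) ^ 2) := by
  cases N
  · generalize hx : lam * Real.tanh (r / 2) = x
    simp only [S', profile, curv, Real.cos_two_mul, Real.cos_sq_arctan, hx]
    field_simp
    ring
  · have h := abs_lt.mp (h rfl)
    generalize hx : lam * Real.tanh (r / 2) = x at *
    have hp : 0 < 1 - x ^ 2 := by nlinarith
    simp only [S', profile, curv, Real.cosh_two_mul, Real.sinh_artanh h, Real.cosh_artanh h, hx]
    rw [div_pow, div_pow, Real.sq_sqrt hp.le, ← add_div]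
    ring

/-- The denominator in the algebraic form of the harmonic map. -/
def mapDenom (N : Target) (lam : ℝ) (y : Plane) : ℝ :=
  coshRadius y + 1 + N.curv * lam ^ 2 * (coshRadius y - 1)

theorem mapDenom_pos (N : Target) {lam : ℝ} (h : N = .hyperbolic → lam ^ 2 < 1) (y : Plane) :
    0 < mapDenom N lam y := by
  have hc := one_le_coshRadius y
  cases N
  · simp only [mapDenom, Target.curv]; nlinarith [sq_nonneg lam]
  · have := h rfl
    simp only [mapDenom, Target.curv]; nlinarith

/-- Double-angle formulas make the map rational in `x = λ tanh(r/2)`, and `tanh(r/2) = ‖y‖ / (1 +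
cosh r)` cancels the singular factor `1/‖y‖`. Smoothness across the origin becomes visible. -/
theorem harmonicMap_eq (N : Target) {lam : ℝ} (h : N = .hyperbolic → lam ^ 2 < 1) (y : Plane) :
    harmonicMap N lam y =
      ![2 * lam * y 0 / mapDenom N lam y, 2 * lam * y 1 / mapDenom N lam y,
        2 * (coshRadius y + 1) / mapDenom N lam y - 1] := by
  have hD := mapDenom_pos N h y
  have hc := one_le_coshRadius y
  have hc1 : coshRadius y + 1 ≠ 0 := by linarith
  have hn : ‖y‖ ^ 2 = (coshRadius y - 1) * (coshRadius y + 1) := by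
    have := coshRadius_sq y
    rw [norm_sq_plane]; linarith
  have ht : (lam * Real.tanh (radius y / 2)) ^ 2 =
      lam ^ 2 * (coshRadius y - 1) / (coshRadius y + 1) := by
    rw [tanh_half_radius, mul_pow, div_pow, hn, add_comm 1]
    field_simp
  have hlt : N = .hyperbolic → |lam * Real.tanh (radius y / 2)| < 1 := by
    intro hN
    rw [abs_mul]
    have h1 : |lam| < 1 := (sq_lt_one_iff_abs_lt_one lam).mp (h hN)
    have h2 := Real.abs_tanh_lt_one (radius y / 2)
    nlinarith [abs_nonneg lam, abs_nonneg (Real.tanh (radius y / 2))]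
  have hden : 1 + N.curv * (lam * Real.tanh (radius y / 2)) ^ 2 =
      mapDenom N lam y / (coshRadius y + 1) := by
    rw [ht, mapDenom]; field_simp
  have hS : N.S (N.profile lam (radius y)) = 2 * lam * ‖y‖ / mapDenom N lam y := by
    rw [N.S_profile hlt, hden, tanh_half_radius, add_comm 1]
    field_simp
  have hS' : N.S' (N.profile lam (radius y)) =
      2 * (coshRadius y + 1) / mapDenom N lam y - 1 := by
    rw [N.S'_profile hlt, hden, show 1 - N.curv * (lam * Real.tanh (radius y / 2)) ^ 2 =
      2 - mapDenom N lam y / (coshRadius y + 1) by rw [← hden]; ring]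
    field_simp
  have hcancel : ∀ j, ‖y‖ * (y j / ‖y‖) = y j := by
    intro j
    rcases eq_or_ne y 0 with rfl | hy
    · simp
    · exact mul_div_cancel₀ _ (norm_ne_zero_iff.mpr hy)
  have hcoord : ∀ j, 2 * lam * ‖y‖ / mapDenom N lam y * (y j / ‖y‖) =
      2 * lam * y j / mapDenom N lam y := by
    intro j
    rw [div_mul_eq_mul_div, mul_assoc (2 * lam), hcancel]
  rw [harmonicMap, hS, hS', hcoord, hcoord]

theorem contDiff_mapDenom (N : Target) (lam : ℝ) : ContDiff ℝ ∞ (mapDenom N lam) :=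
  (contDiff_coshRadius.add contDiff_const).add
    (contDiff_const.mul (contDiff_coshRadius.sub contDiff_const))

theorem contDiff_harmonicMap (N : Target) {lam : ℝ} (h : N = .hyperbolic → lam ^ 2 < 1) :
    ContDiff ℝ ∞ (harmonicMap N lam) := by
  rw [funext (harmonicMap_eq N h)]
  have hD := contDiff_mapDenom N lam
  have h0 := fun y => (mapDenom_pos N h y).ne'
  refine contDiff_pi.mpr fun i => ?_
  fin_cases i
  · exact (contDiff_const.mul (contDiff_coord 0)).div hD h0
  · exact (contDiff_const.mul (contDiff_coord 1)).div hD h0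
  · exact ((contDiff_const.mul (contDiff_coshRadius.add contDiff_const)).div hD h0).sub
      contDiff_const

/-! ### Bounds on the curvature term -/

section

variable {N : Target} {Q φ : Plane → Ambient}

theorem form_fderiv_base (hQ : ContDiff ℝ ∞ Q) (hS : ∀ y, Q y ∈ N.surface) (v y : Plane) :
    N.form (fderiv ℝ Q y v) (Q y) = 0 := by
  have hd : DifferentiableAt ℝ Q y := hQ.differentiable (by simp) y
  have h := fderiv_form N hd hd v
  rw [show (fun x => N.form (Q x) (Q x)) = fun _ => N.curv from
    funext fun x => N.form_self_of_mem (hS x), N.form_comm (Q y)] at h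
  simp at h
  linarith

/-- The curvature term, in terms of the energy density of the map. -/
theorem curvTerm_eq (y : Plane) :
    curvTerm N Q φ y = N.curv *
      ((N.form (fderiv ℝ Q y (basisVec 0)) (fderiv ℝ Q y (basisVec 0)) * N.form (φ y) (φ y)
          - N.form (fderiv ℝ Q y (basisVec 0)) (φ y) * N.form (fderiv ℝ Q y (basisVec 0)) (φ y))
        + (N.form (fderiv ℝ Q y (basisVec 1)) (fderiv ℝ Q y (basisVec 1)) * N.form (φ y) (φ y)
          - N.form (fderiv ℝ Q y (basisVec 1)) (φ y) * N.form (fderiv ℝ Q y (basisVec 1)) (φ y))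
        + (N.form (fderiv ℝ Q y y) (fderiv ℝ Q y y) * N.form (φ y) (φ y)
          - N.form (fderiv ℝ Q y y) (φ y) * N.form (fderiv ℝ Q y y) (φ y))) := by
  -- The inverse metric is `e₀ ⊗ e₀ + e₁ ⊗ e₁ + y ⊗ y`, so the contraction splits into one Gram
  -- determinant for each of these three vectors.
  have hy : fderiv ℝ Q y y =
      y 0 • fderiv ℝ Q y (basisVec 0) + y 1 • fderiv ℝ Q y (basisVec 1) := by
    rw [← map_smul, ← map_smul, ← map_add, ← plane_eq]
  rw [hy]
  generalize hA : fderiv ℝ Q y (basisVec 0) = A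
  generalize hB : fderiv ℝ Q y (basisVec 1) = B
  simp only [curvTerm, Fin.sum_univ_two, hA, hB, invMetric_eq, Target.curvOp, Target.form_sub_left,
    Target.form_add_left, Target.form_add_right, Target.form_smul_left, Target.form_smul_right,
    N.form_comm (φ y) _, N.form_comm B A]
  simp
  ring

/-- Each Gram determinant is nonnegative by Cauchy–Schwarz, and `κ = -1`. -/
theorem curvTerm_nonpos {Q φ : Plane → Ambient} (hQ : ContDiff ℝ ∞ Q)
    (hS : ∀ y, Q y ∈ Target.hyperbolic.surface) (hφ : IsTestSection .hyperbolic Q φ) (y : Plane) :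
    curvTerm .hyperbolic Q φ y ≤ 0 := by
  have h := fun v => Target.hyperbolic.form_mul_self_le (hS y) (form_fderiv_base hQ hS v y)
    (hφ.tangent y)
  rw [curvTerm_eq]
  simp only [Target.curv]
  linarith [h (basisVec 0), h (basisVec 1), h y]

end

/-- The last factor is the domain metric on `v`: the map is conformal, with an explicit conformal
factor. -/
theorem sphere_form_fderiv (lam : ℝ) (v y : Plane) :
    Target.sphere.form (fderiv ℝ (harmonicMap .sphere lam) y v)
        (fderiv ℝ (harmonicMap .sphere lam) y v) =
      4 * lam ^ 2 / mapDenom .sphere lam y ^ 2 *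
        (v 0 ^ 2 + v 1 ^ 2 - (y 0 * v 0 + y 1 * v 1) ^ 2 / coshRadius y ^ 2) := by
  have hN : Target.sphere = .hyperbolic → lam ^ 2 < 1 := fun h => nomatch h
  have hD := (mapDenom_pos .sphere hN y).ne'
  have hc := (coshRadius_pos y).ne'
  have hQ := hasFDerivAt_pi'.mp
    ((contDiff_harmonicMap .sphere hN).differentiable (by simp) y).hasFDerivAt
  have hcd : HasFDerivAt coshRadius _ y :=
    (hasFDerivAt_coshRadius y).differentiableAt.hasFDerivAt
  have hDd : HasFDerivAt (mapDenom .sphere lam) _ y :=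
    (hcd.add_const 1).add ((hcd.sub_const 1).const_mul (Target.sphere.curv * lam ^ 2))
  have e0 : (fun x => harmonicMap .sphere lam x 0) =
      fun x => 2 * lam * x 0 / mapDenom .sphere lam x := by
    ext x; rw [harmonicMap_eq _ hN]; rfl
  have e1 : (fun x => harmonicMap .sphere lam x 1) =
      fun x => 2 * lam * x 1 / mapDenom .sphere lam x := by
    ext x; rw [harmonicMap_eq _ hN]; rfl
  have e2 : (fun x => harmonicMap .sphere lam x 2) =
      fun x => 2 * (coshRadius x + 1) / mapDenom .sphere lam x - 1 := by
    ext x; rw [harmonicMap_eq _ hN]; rfl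
  have d0 := hQ 0
  have d1 := hQ 1
  have d2 := hQ 2
  rw [e0] at d0
  rw [e1] at d1
  rw [e2] at d2
  have f0 := DFunLike.congr_fun (d0.unique
    (hasFDerivAt_div ((hasFDerivAt_coord 0 y).const_mul (2 * lam)) hDd hD)) v
  have f1 := DFunLike.congr_fun (d1.unique
    (hasFDerivAt_div ((hasFDerivAt_coord 1 y).const_mul (2 * lam)) hDd hD)) v
  have f2 := DFunLike.congr_fun (d2.unique
    ((hasFDerivAt_div ((hcd.add_const 1).const_mul 2) hDd hD).sub_const 1)) v
  simp [fderiv_coshRadius, Target.curv] at f0 f1 f2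
  have h2 : y 0 ^ 2 + y 1 ^ 2 = coshRadius y ^ 2 - 1 := by linarith [coshRadius_sq y]
  have f2' : fderiv ℝ (harmonicMap .sphere lam) y v 2 =
      -4 * lam ^ 2 * (y 0 * v 0 + y 1 * v 1) / (coshRadius y * mapDenom .sphere lam y ^ 2) := by
    rw [f2]
    field_simp
    simp only [mapDenom, Target.curv]
    ring
  -- Writing `D` for the denominator, `D - (1 + λ²) cosh r = 1 - λ²`; squared, this is the only
  -- relation between `D` and `cosh r` that the final identity needs.
  have hD2 : (mapDenom .sphere lam y - (1 + lam ^ 2) * coshRadius y) ^ 2 =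
      (1 + lam ^ 2) ^ 2 - 4 * lam ^ 2 := by simp only [mapDenom, Target.curv]; ring
  simp only [Target.form, f0, f1, f2', Target.curv]
  generalize mapDenom .sphere lam y = D at *
  generalize coshRadius y = c at *
  field_simp
  linear_combination 4 * lam ^ 2 * (y 0 * v 0 + y 1 * v 1) ^ 2 * (hD2 + (1 + lam ^ 2) ^ 2 * h2)

theorem sphere_curvTerm_le {lam : ℝ} (hlam : lam ^ 2 ≤ 1 / 64) {φ : Plane → Ambient} (y : Plane) :
    curvTerm .sphere (harmonicMap .sphere lam) φ y ≤
      1 / 8 * hardyWeight y ^ 2 * Target.sphere.form (φ y) (φ y) := by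
  have hn : 0 ≤ Target.sphere.form (φ y) (φ y) := by
    simp only [Target.form, Target.curv]
    nlinarith [mul_self_nonneg (φ y 0), mul_self_nonneg (φ y 1), mul_self_nonneg (φ y 2)]
  have hc := one_le_coshRadius y
  have hN : Target.sphere = .hyperbolic → lam ^ 2 < 1 := fun h => nomatch h
  have hD := mapDenom_pos .sphere hN y
  have hD1 : coshRadius y + 1 ≤ mapDenom .sphere lam y := by
    simp only [mapDenom, Target.curv]; nlinarith [sq_nonneg lam]
  have hinv : (mapDenom .sphere lam y)⁻¹ ≤ hardyWeight y :=
    (inv_anti₀ (by linarith) (by linarith)).trans (inv_le_hardyWeight y)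
  have hsq : (mapDenom .sphere lam y)⁻¹ ^ 2 ≤ hardyWeight y ^ 2 :=
    pow_le_pow_left₀ (inv_pos.mpr hD).le hinv 2
  -- The bound `λ² ≤ 1/64` is chosen to make `8 λ² ≤ 1/8`, half of the available `1/4`.
  have henergy : 8 * lam ^ 2 * (mapDenom .sphere lam y)⁻¹ ^ 2 ≤ 1 / 8 * hardyWeight y ^ 2 := by
    nlinarith [sq_nonneg (mapDenom .sphere lam y)⁻¹]
  refine le_trans ?_ (mul_le_mul_of_nonneg_right henergy hn)
  have hc2 := coshRadius_sq y
  have hc0 := (coshRadius_pos y).ne'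
  -- The trace `|dQ|²` of a conformal pullback in dimension two is twice the conformal factor. The
  -- squares `(dQ(v), φ)²` enter the curvature term with a negative sign and are dropped below.
  have hkey : 4 * lam ^ 2 / mapDenom .sphere lam y ^ 2 * (1 - y 0 ^ 2 / coshRadius y ^ 2)
      + 4 * lam ^ 2 / mapDenom .sphere lam y ^ 2 * (1 - y 1 ^ 2 / coshRadius y ^ 2)
      + 4 * lam ^ 2 / mapDenom .sphere lam y ^ 2 *
        (y 0 ^ 2 + y 1 ^ 2 - (y 0 * y 0 + y 1 * y 1) ^ 2 / coshRadius y ^ 2) =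
      8 * lam ^ 2 * (mapDenom .sphere lam y)⁻¹ ^ 2 := by
    field_simp
    rw [hc2]
    ring
  rw [curvTerm_eq, sphere_form_fderiv, sphere_form_fderiv, sphere_form_fderiv, ← hkey]
  simp only [Target.curv]
  simp
  nlinarith [mul_self_nonneg (Target.sphere.form
      (fderiv ℝ (harmonicMap .sphere lam) y (basisVec 0)) (φ y)), mul_self_nonneg
      (Target.sphere.form (fderiv ℝ (harmonicMap .sphere lam) y (basisVec 1)) (φ y)),
      mul_self_nonneg (Target.sphere.form (fderiv ℝ (harmonicMap .sphere lam) y y) (φ y))]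

theorem stronglyStable_hyperbolic {lam : ℝ} (h : lam ^ 2 < 1) :
    StronglyStable .hyperbolic (harmonicMap .hyperbolic lam) := by
  have hQ := contDiff_harmonicMap .hyperbolic fun _ => h
  have hS := harmonicMap_mem .hyperbolic lam
  refine stronglyStable_of_curvTerm_le hQ hS fun φ hφ y => ?_
  refine (curvTerm_nonpos hQ hS hφ y).trans ?_
  exact mul_nonneg (by positivity) (Target.hyperbolic.form_self_nonneg (hS y) (hφ.tangent y))

theorem stronglyStable_sphere {lam : ℝ} (h : lam ^ 2 ≤ 1 / 64) :
    StronglyStable .sphere (harmonicMap .sphere lam) :=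
  stronglyStable_of_curvTerm_le (contDiff_harmonicMap .sphere fun h => nomatch h)
    (harmonicMap_mem .sphere lam) fun _ _ => sphere_curvTerm_le h

end

end HarmonicStability

theorem mainTheorem5 :
    (∀ β : ℝ, 0 ≤ β →
      HarmonicStability.StronglyStable HarmonicStability.Target.hyperbolic
        (HarmonicStability.harmonicMap HarmonicStability.Target.hyperbolic
          (Real.tanh (β / 2)))) ∧
    (∃ α₀ : ℝ, 0 < α₀ ∧ α₀ < Real.pi ∧ ∀ α : ℝ, 0 ≤ α → α < α₀ →
      HarmonicStability.StronglyStable HarmonicStability.Target.sphere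
        (HarmonicStability.harmonicMap HarmonicStability.Target.sphere
          (Real.tan (α / 2)))) := by
  -- This `α₀` makes `λ = tan(α/2) < 1/8`, hence `λ² ≤ 1/64`.
  refine ⟨fun β _ => HarmonicStability.stronglyStable_hyperbolic ?_, 2 * Real.arctan (1 / 8),
    ?_, ?_, fun α h0 hα => HarmonicStability.stronglyStable_sphere ?_⟩
  · exact (sq_lt_one_iff_abs_lt_one _).mpr (Real.abs_tanh_lt_one _)
  · have := Real.arctan_pos.mpr (by norm_num : (0 : ℝ) < 1 / 8)
    linarith
  · linarith [Real.arctan_lt_pi_div_two (1 / 8)]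
  · have h1 : 0 ≤ Real.tan (α / 2) := Real.tan_nonneg_of_nonneg_of_le_pi_div_two (by linarith)
      (by linarith [Real.arctan_lt_pi_div_two (1 / 8)])
    have h2 : Real.tan (α / 2) < Real.tan (Real.arctan (1 / 8)) :=
      Real.tan_lt_tan_of_lt_of_lt_pi_div_two (by linarith [Real.pi_pos])
        (Real.arctan_lt_pi_div_two _) (by linarith)
    rw [Real.tan_arctan] at h2
    nlinarith
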